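/- **Setting.** Identify finite binary strings with natural numbers by $\epsilon\mapsto 0,\ 0\mapsto 1,\ 1\mapsto 2,\ 00\mapsto 3,\dots$. Let $\Phi(p\,|\,y)$ be a fixed optimal universal prefix-free machine, where $p$ is a binary program, and the input $y$ and the output are finite tuples of natural numbers. That is, for each $y$ the set of halting programs is prefix-free, and each partial computable machine with this property is simulated by $\Phi$ uniformly in $y$, with $O(1)$ additional program bits. Let $\Phi_t$ be its computable $t$-step approximations (an output once given is kept, and within $t$ steps at most $t$ program bits are read). Let $x$ be a binary string of length $n=l(x)$. All complexities are conditional on $n$: - $K(x)=\min\{l(p):\Phi(p|n)=x\}$ and $K_t(x)=\min\{l(p):\Phi_t(p|n)=x\}$ (with $\min\emptyset=\infty$). - $\Omega^n_t=\sum\{2^{-l(p)}:\Phi_t(p|n)\in\{0,1\}^n\}$, $\Omega^n=\lim_t\Omega^n_t$, $t_k=\min\{t:\Omega^n-\Omega^n_t\le 2^{-k}\}$. The $m$-depth of $x$ with constant $b$ is $k_x=\min\{k: K_{t_k}(x)\le K(x)+b\}$. - $H$ is the Halting sequence, $H^n_i=1$ if $\Phi(i|n)$ halts and $0$ otherwise.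 $K^H(x)$ is the complexity of $x$, given $n$, on an optimal universal prefix-free machine with oracle $H$, and $I(x;H)=K(x)-K^H(x)$. - A sufficient statistic of $x$ with constant $a$ is one of the following. - $Z=S$: a finite set $S\ni x$ of strings with $\big|K(S)+\log_2|S|-K(x)\big|\le a$. - $Z=P$: a computable semimeasure $P\ge 0$ (that is, $\sum_{y\in\{0,1\}^m}P(y)\le 1$ for every $m$) with $P(x)>0$ and $\big|K(P)-\log_2P(x)-K(x)\big|\le a$. - $Z=F$: a computable function $F$, defined on a decidable prefix-free set of strings, with $\big|K(F)+l(d)-K(x)\big|\le a$ for some $d$ with $F(d)=x$. Here $K(S)$, $K(P)$, $K(F)$ are the least lengths of programs on $\Phi$ that, given $n$, respectively list all elements of $S$ and halt; compute $P(y)$ to within $2^{-k}$ from any $(y,k)$; decide from any $d$ whether $F(d)$ is defined and compute it if so. - $l^Z_x$ is the least complexity $K(Z)$ of a sufficient statistic of type $Z$ of $x$ with constant $a$. **Proposition 5.1.** For all sufficiently large constants $a$, $b$ and for each $Z\in\{S,P,F\}$ there is a constant $D$ such that: 1. for every $c$ and every $m$ there are infinitely many $x$ with $$k_x\ge m,\qquad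 l^Z_x\ \ge\ (k_x)^c-D,\qquad I(x;H)\ \le\ k_x+D;$$ 2. there is a $\nu>0$ such that there are infinitely many $x$ with $$l^Z_x\ \ge\ \nu\, l(x)+k_x-D,\qquad I(x;H)\ \le\ k_x+D.$$ -/

import Mathlib

open scoped ENNReal

namespace AlgStat

/-- The natural bijection between finite binary strings and natural numbers:
`ε ↦ 0`, `0 ↦ 1`, `1 ↦ 2`, `00 ↦ 3`, `01 ↦ 4`, and so on. -/
def code (x : List Bool) : ℕ :=
  x.foldl (fun m b => 2 * m + 1 + b.toNat) 0

/-- A machine maps a program (a binary string) and a conditional input (a finite tuple of natural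
numbers) to at most one output (a finite tuple of natural numbers). Binary strings are passed to
and returned by machines through `code`. -/
abbrev Machine := List Bool → List ℕ →. List ℕ

/-- For every conditional input, the set of halting programs is prefix-free. -/
def PrefixFree (M : Machine) : Prop :=
  ∀ (y : List ℕ) (p q : List Bool), (M p y).Dom → (M q y).Dom → p <+: q → p = q

/-- `U` is an optimal universal prefix-free machine among the machines that are partial recursive
relative to the oracles in `O` (`O = ∅` is the case without oracle): it simulates each such machine,
uniformly in the conditional input, at the cost of a constant number of additional program bits. -/
def IsUniversal (O : Set (ℕ →. ℕ)) (U : Machine) : Prop :=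
  PrefixFree U ∧ RecursiveIn₂ O U ∧
    ∀ M : Machine, PrefixFree M → RecursiveIn₂ O M →
      ∃ c : ℕ, ∀ p : List Bool, ∃ q : List Bool, q.length ≤ p.length + c ∧ ∀ y, U q y = M p y

/-- A machine together with its computation stages: `run t p y` is the output, if there is any,
of the program `p` on the input `y` within `t` steps. Stages are computable, an output once given
is kept, and within `t` steps at most `t` bits of a program are read. -/
structure Interpreter where
  run : ℕ → List Bool → List ℕ → Option (List ℕ)
  computable : Computable fun a : ℕ × List Bool × List ℕ => run a.1 a.2.1 a.2.2
  mono : ∀ {t t' : ℕ} {p : List Bool} {y w : List ℕ},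
    t ≤ t' → run t p y = some w → run t' p y = some w
  length_le : ∀ {t : ℕ} {p : List Bool} {y w : List ℕ}, run t p y = some w → p.length ≤ t

/-- The limit of the stages of an interpreter. -/
def Interpreter.eval (Φ : Interpreter) : Machine :=
  fun p y => Nat.rfindOpt fun t => Φ.run t p y

theorem Interpreter.mem_eval (Φ : Interpreter) {p : List Bool} {y w : List ℕ} :
    w ∈ Φ.eval p y ↔ ∃ t, Φ.run t p y = some w :=
  Nat.rfindOpt_mono fun h h' => Φ.mono h h'

/-- Prefix complexity `K(x)` on the machine `M`, conditional to the length `n` of `x`. -/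
noncomputable def K (M : Machine) (x : List Bool) : ℕ :=
  sInf {l | ∃ p : List Bool, p.length = l ∧ [code x] ∈ M p [x.length]}

/-- The time-bounded complexity `K_t(x)`, infinite if there is no program within `t` steps. -/
noncomputable def Kt (Φ : Interpreter) (t : ℕ) (x : List Bool) : ℕ∞ :=
  sInf {l | ∃ p : List Bool, (p.length : ℕ∞) = l ∧ Φ.run t p [x.length] = some [code x]}

/-- `Ω^n_t`: the total weight of the programs that, given `n`, output a string of length `n`
within `t` steps. -/
noncomputable def omegaAt (Φ : Interpreter) (n t : ℕ) : ℝ≥0∞ :=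
  ∑' p : {p : List Bool // ∃ x : List Bool, x.length = n ∧ Φ.run t p [n] = some [code x]},
    2⁻¹ ^ p.1.length

/-- `Ω^n`, the limit of the nondecreasing sequence `Ω^n_t`. -/
noncomputable def omega (Φ : Interpreter) (n : ℕ) : ℝ≥0∞ :=
  ⨆ t, omegaAt Φ n t

/-- `t_k`: the least `t` with `Ω^n - Ω^n_t ≤ 2^{-k}`. -/
noncomputable def settleTime (Φ : Interpreter) (n k : ℕ) : ℕ :=
  sInf {t | omega Φ n - omegaAt Φ n t ≤ 2⁻¹ ^ k}

/-- The computational `m`-depth `k_x` with additive constant `b`: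
the least `k` such that `K_{t_k}(x) ≤ K(x) + b`. -/
noncomputable def depth (Φ : Interpreter) (b : ℕ) (x : List Bool) : ℕ :=
  sInf {k | Kt Φ (settleTime Φ x.length k) x ≤ (K Φ.eval x : ℕ∞) + b}

open Classical in
/-- The Halting sequence: `1` if the `i`-th program halts given `n`, and `0` otherwise. -/
noncomputable def haltingBit (Φ : Interpreter) (n i : ℕ) : ℕ :=
  if ∃ p : List Bool, code p = i ∧ (Φ.eval p [n]).Dom then 1 else 0

/-- The Halting sequence as an oracle, queried at the pair `(n, i)`. -/
noncomputable def haltingOracle (Φ : Interpreter) : ℕ →. ℕ :=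
  fun m => Part.some (haltingBit Φ m.unpair.1 m.unpair.2)

/-- `I(x;H) = K(x) - K^H(x)`, where `Ψ` is the machine with oracle that defines `K^H`. -/
noncomputable def haltingInfo (Φ : Interpreter) (Ψ : Machine) (x : List Bool) : ℤ :=
  (K Φ.eval x : ℤ) - (K Ψ x : ℤ)

/-! In what follows `n` is the length of the string under consideration. It is available to all
programs. -/

/-- `K(S)`: the length of a shortest program that, given `n`, lists the elements of `S` and
halts. -/
noncomputable def setK (Φ : Interpreter) (n : ℕ) (S : Finset (List Bool)) : ℕ :=
  sInf {l | ∃ p : List Bool, p.length = l ∧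
    ∃ L : List (List Bool), L.toFinset = S ∧ L.map code ∈ Φ.eval p [n]}

/-- `S` is a sufficient set statistic of `x`, with additive constant `a`. -/
def IsSetStatistic (Φ : Interpreter) (a : ℕ) (x : List Bool) (S : Finset (List Bool)) : Prop :=
  x ∈ S ∧ |(setK Φ x.length S : ℝ) + Real.logb 2 S.card - K Φ.eval x| ≤ a

/-- A (length conditional) semimeasure. -/
def IsSemimeasure (P : List Bool → ℝ) : Prop :=
  (∀ y, 0 ≤ P y) ∧ ∀ m : ℕ, ∑ v : Fin m → Bool, P (List.ofFn v) ≤ 1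

/-- Given `n`, the program `p` computes the real-valued function `P`: for each `y` and each
precision `k` it halts with a numerator `r` such that `r / 2^k` is within `2^{-k}` of `P y`. -/
def ComputesReal (Φ : Interpreter) (n : ℕ) (p : List Bool) (P : List Bool → ℝ) : Prop :=
  ∀ (y : List Bool) (k : ℕ), ∃ r : ℕ, [r] ∈ Φ.eval p [code y, k, n] ∧
    |P y - (r : ℝ) / 2 ^ k| ≤ 1 / 2 ^ k

/-- `K(P)` for a computable semimeasure `P`, given `n`. -/
noncomputable def probK (Φ : Interpreter) (n : ℕ) (P : List Bool → ℝ) : ℕ :=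
  sInf {l | ∃ p : List Bool, p.length = l ∧ ComputesReal Φ n p P}

/-- `P` is a sufficient probabilistic statistic of `x`, with additive constant `a`. -/
def IsProbStatistic (Φ : Interpreter) (a : ℕ) (x : List Bool) (P : List Bool → ℝ) : Prop :=
  IsSemimeasure P ∧ (∃ p, ComputesReal Φ x.length p P) ∧ 0 < P x ∧
    |(probK Φ x.length P : ℝ) - Real.logb 2 (P x) - K Φ.eval x| ≤ a

/-- Given `n`, the program `p` computes `F`: it halts on every `d`, with output the value `F d`, or
the empty tuple where `F` has no value. -/
def ComputesFun (Φ : Interpreter) (n : ℕ) (p : List Bool)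
    (F : List Bool → Option (List Bool)) : Prop :=
  ∀ d : List Bool, ((F d).map code).toList ∈ Φ.eval p [code d, n]

/-- `K(F)` for a computable function `F`, given `n`. -/
noncomputable def funK (Φ : Interpreter) (n : ℕ) (F : List Bool → Option (List Bool)) : ℕ :=
  sInf {l | ∃ p : List Bool, p.length = l ∧ ComputesFun Φ n p F}

/-- The set of arguments where `F` has a value is prefix-free. -/
def PrefixFreeFun (F : List Bool → Option (List Bool)) : Prop :=
  ∀ d e : List Bool, (F d).isSome → (F e).isSome → d <+: e → d = e

/-- `F` is a sufficient function statistic of `x`, with additive constant `a`. -/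
def IsFunStatistic (Φ : Interpreter) (a : ℕ) (x : List Bool)
    (F : List Bool → Option (List Bool)) : Prop :=
  PrefixFreeFun F ∧ (∃ p, ComputesFun Φ x.length p F) ∧
    ∃ d : List Bool, F d = some x ∧ |(funK Φ x.length F : ℝ) + d.length - K Φ.eval x| ≤ a

/-- The three types of statistics. -/
inductive StatKind
  | set
  | prob
  | func

/-- `l^Z_x`: the complexity of a minimal sufficient statistic of `x` of the given kind, where
sufficiency is with additive constant `a`. (For `a` at least some constant depending on the
interpreter only, each string has a sufficient statistic of each kind; the convention `sInf ∅ = 0`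
makes lower bounds fail where there is none.) -/
noncomputable def statLen (Φ : Interpreter) (a : ℕ) (Z : StatKind) (x : List Bool) : ℕ :=
  match Z with
  | .set => sInf {l | ∃ S, IsSetStatistic Φ a x S ∧ setK Φ x.length S = l}
  | .prob => sInf {l | ∃ P, IsProbStatistic Φ a x P ∧ probK Φ x.length P = l}
  | .func => sInf {l | ∃ F, IsFunStatistic Φ a x F ∧ funK Φ x.length F = l}

end AlgStat

/-! Fix the length n = 4q. A program becomes a model, of one of three kinds, once it has halted on
the finitely many inputs that matter at length n and the weights it gives to the strings of length n
sum to at most 2. A model of complexity l counts with mass 2^{-l}. Kraft's inequality for each kind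
bounds the total mass by 3, and models of total mass μ that give weight at least 2^{l-A-2} reach at
most 2^{A+3} μ strings (`card_covered_le`). If a statistic Z of x has two-part code length at most
A, then a program of length K(Z) becomes a model that gives x weight at least 2^{K(Z)-A-2}, so all
three kinds of statistics are handled at once.

Strings are enumerated, each outside everything that the models present at that moment cover. String
number v < 2^q is found from the q bits of v, so its complexity is at most q + O(1). There are
2^{e+4} levels with increasing thresholds lo_i. Put k = lo_i + 3. Level i blocks the enumeration as
long as, since the start of the window of the latest 2^{q-k} strings, the new models of complexity
in [lo_i, lo_{i+1}) have mass below 2^{-k-e} and all new models have mass below 6·2^{-k}. If 2^q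
strings were produced, each level would have received mass at least (3/8)·2^{-e}, in total 6 > 3
(`length_history_lt`). So the enumeration comes to rest, with some window quiet forever
(`exists_quiet_window`).

Most strings x of this window are as required, by counting (`exists_gap`). Too few new models exist
to compress x much below q or, with complexity below lo_{i+1}, to be sufficient for x. The short
programs of x halt after the window began, when less than 2^{-lo_i} of Ω is missing, so the depth
exceeds lo_i. Conversely, few of the 2^{q-k} programs of length about q can halt after Ω has settled
up to 2^{-k-O(1)}, so the depth is lo_i + O(1) for most x. Finally, no machine, with or without
oracle, compresses most of 2^{q-k} strings much below q - k, whence I(x;H) ≤ k + O(1).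

It remains to choose the levels: lo_{i+1} = 2^{lo_i} gives the first claim, lo_{i+1} = 4 lo_i with
lo_0 proportional to q the second. The parameter e must exceed a; it is read off from q by
unpairing, so that a single machine, and hence a single additive constant, serves all a. -/

namespace AlgStat

open Finset

/-! ### Closure properties of computable functions. -/

section Computability

variable {α σ : Type*} [Primcodable α] [Primcodable σ]

theorem computable_add {f g : α → ℕ} (hf : Computable f) (hg : Computable g) :
    Computable fun a => f a + g a := Primrec.nat_add.to_comp.comp hf hg

theorem computable_sub {f g : α → ℕ} (hf : Computable f) (hg : Computable g) :
    Computable fun a => f a - g a := Primrec.nat_sub.to_comp.comp hf hg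

theorem computable_mul {f g : α → ℕ} (hf : Computable f) (hg : Computable g) :
    Computable fun a => f a * g a := Primrec.nat_mul.to_comp.comp hf hg

theorem computable_div {f g : α → ℕ} (hf : Computable f) (hg : Computable g) :
    Computable fun a => f a / g a := Primrec.nat_div.to_comp.comp hf hg

theorem primrec_two_pow : Primrec fun n : ℕ => 2 ^ n := by
  refine (Primrec.nat_rec₁ 1 (f := fun _ r => 2 * r)
    (Primrec.nat_mul.comp (Primrec.const 2) Primrec.snd).to₂).of_eq fun n => ?_
  induction n with
  | zero => rfl
  | succ n ih => rw [pow_succ, mul_comm, ← ih]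

theorem computable_two_pow {f : α → ℕ} (hf : Computable f) : Computable fun a => 2 ^ f a :=
  primrec_two_pow.to_comp.comp hf

theorem computable_sum_range {f : α → ℕ → ℕ} {g : α → ℕ} (hg : Computable g)
    (hf : Computable₂ f) : Computable fun a => ∑ i ∈ range (g a), f a i := by
  refine (Computable.nat_rec (σ := ℕ) hg (Computable.const 0)
    (h := fun a p => p.2 + f a p.1) ?_).of_eq fun a => ?_
  · exact computable_add (Computable.snd.comp Computable.snd)
      (hf.comp Computable.fst (Computable.fst.comp Computable.snd))
  · generalize g a = m
    induction m with
    | zero => rfl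
    | succ m ih => simp only [sum_range_succ, ← ih]

theorem computable_decide_le {f g : α → ℕ} (hf : Computable f) (hg : Computable g) :
    Computable fun a => decide (f a ≤ g a) := Primrec.nat_le.decide.to_comp.comp hf hg

theorem computable_decide_lt {f g : α → ℕ} (hf : Computable f) (hg : Computable g) :
    Computable fun a => decide (f a < g a) := Primrec.nat_lt.decide.to_comp.comp hf hg

theorem computable_decide_eq [DecidableEq σ] {f g : α → σ} (hf : Computable f)
    (hg : Computable g) : Computable fun a => decide (f a = g a) :=
  Primrec.eq.decide.to_comp.comp hf hg

theorem computable_decide_and {p q : α → Prop} [DecidablePred p] [DecidablePred q]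
    (hp : Computable fun a => decide (p a)) (hq : Computable fun a => decide (q a)) :
    Computable fun a => decide (p a ∧ q a) :=
  (Primrec.and.to_comp.comp hp hq).of_eq fun a => by simp

theorem computable_decide_not {p : α → Prop} [DecidablePred p]
    (hp : Computable fun a => decide (p a)) : Computable fun a => decide (¬ p a) :=
  (Primrec.not.to_comp.comp hp).of_eq fun a => by simp

theorem computable_ite {p : α → Prop} [DecidablePred p] {f g : α → σ}
    (hp : Computable fun a => decide (p a)) (hf : Computable f) (hg : Computable g) :
    Computable fun a => if p a then f a else g a :=
  (Computable.cond hp hf hg).of_eq fun a => by by_cases h : p a <;> simp [h]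

theorem computable_decide_mem {f : α → ℕ} {l : α → List ℕ} (hf : Computable f)
    (hl : Computable l) : Computable fun a => decide (f a ∈ l a) := by
  refine (computable_decide_lt ((Primrec.list_idxOf (α := ℕ)).to_comp.comp hf hl)
    (Computable.list_length.comp hl)).of_eq fun a => ?_
  simp [List.idxOf_lt_length_iff]

end Computability

/-! ### The numbering of binary strings and its inverse. -/

theorem code_concat (p : List Bool) (b : Bool) : code (p ++ [b]) = 2 * code p + 1 + b.toNat := by
  simp [code]

theorem length_le_code (p : List Bool) : p.length ≤ code p := by
  induction p using List.reverseRecOn with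
  | nil => simp
  | append_singleton p b ih => simp only [code_concat, List.length_append, List.length_singleton]; omega

theorem two_pow_length_le (p : List Bool) : 2 ^ p.length ≤ code p + 1 := by
  induction p using List.reverseRecOn with
  | nil => simp
  | append_singleton p b ih =>
    simp only [code_concat, List.length_append, List.length_singleton, pow_succ]; omega

theorem code_lt (p : List Bool) : code p + 1 < 2 ^ (p.length + 1) := by
  induction p using List.reverseRecOn with
  | nil => simp [code]
  | append_singleton p b ih =>
    have := b.toNat_le
    simp only [code_concat, List.length_append, List.length_singleton, pow_succ] at *; omega

/-- One step of the inversion of `code`: the last bit of the string with code `s.1` is moved to the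
front of `s.2`. -/
def uncodeStep (s : ℕ × List Bool) : ℕ × List Bool :=
  if s.1 = 0 then s else ((s.1 - 1) / 2, decide ((s.1 - 1) % 2 = 1) :: s.2)

/-- The inverse of `code`. -/
def uncode (i : ℕ) : List Bool := (uncodeStep^[i] (i, [])).2

/-- Surplus steps are harmless because the code 0 is a fixed point. This lets `uncode` use the code
itself, which bounds the length, as the number of steps. -/
theorem uncodeStep_iterate (p : List Bool) : ∀ (l : List Bool) (m : ℕ), p.length ≤ m →
    uncodeStep^[m] (code p, l) = (0, p ++ l) := by
  induction p using List.reverseRecOn with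
  | nil =>
    intro l m _
    have : Function.IsFixedPt uncodeStep (0, l) := by simp [Function.IsFixedPt, uncodeStep]
    simpa [code] using (this.iterate m).eq
  | append_singleton p b ih =>
    intro l m hm
    obtain ⟨m, rfl⟩ : ∃ m', m = m' + 1 := ⟨m - 1, by simp at hm; omega⟩
    have : uncodeStep (code (p ++ [b]), l) = (code p, b :: l) := by
      cases b <;> simp [uncodeStep, code_concat]
      omega
    rw [Function.iterate_succ_apply, this, ih _ _ (by simpa using hm)]
    simp

theorem uncode_code (p : List Bool) : uncode (code p) = p := by
  simp [uncode, uncodeStep_iterate p [] _ (length_le_code p)]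

theorem code_injective : Function.Injective code := Function.LeftInverse.injective uncode_code

theorem primrec_uncode : Primrec uncode := by
  have hs : Primrec uncodeStep := by
    unfold uncodeStep
    have h1 : Primrec fun s : ℕ × List Bool => s.1 - 1 :=
      Primrec.nat_sub.comp Primrec.fst (Primrec.const 1)
    refine Primrec.ite (Primrec.eq.comp Primrec.fst (Primrec.const 0)) Primrec.id
      (Primrec.pair (Primrec.nat_div.comp h1 (Primrec.const 2)) (Primrec.list_cons.comp ?_ Primrec.snd))
    exact Primrec.eq.decide.comp (Primrec.nat_mod.comp h1 (Primrec.const 2)) (Primrec.const 1)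
  exact Primrec.snd.comp (Primrec.nat_iterate Primrec.id (Primrec.pair Primrec.id (Primrec.const []))
    (hs.comp Primrec.snd).to₂)

theorem primrec_code : Primrec code := by
  unfold code
  refine Primrec.list_foldl (h := fun _ (x : ℕ × Bool) => 2 * x.1 + 1 + x.2.toNat) Primrec.id (Primrec.const 0) ?_
  have h2 : Primrec fun b : Bool => b.toNat := Primrec.dom_bool _
  have hs : Primrec fun x : List Bool × ℕ × Bool => x.2 := Primrec.snd
  exact Primrec.nat_add.comp (Primrec.nat_add.comp (Primrec.nat_mul.comp (Primrec.const 2)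
    (Primrec.fst.comp hs)) (Primrec.const 1)) (h2.comp (Primrec.snd.comp hs))

theorem exists_code_eq (i : ℕ) : ∃ p, code p = i := by
  induction i using Nat.strong_induction_on with
  | _ i ih =>
    rcases Nat.eq_zero_or_pos i with rfl | hi
    · exact ⟨[], rfl⟩
    · obtain ⟨p, hp⟩ := ih ((i - 1) / 2) (by omega)
      refine ⟨p ++ [decide ((i - 1) % 2 = 1)], ?_⟩
      rw [code_concat, hp]
      rcases Nat.mod_two_eq_zero_or_one (i - 1) with h | h <;> simp [h] <;> omega

theorem code_uncode (i : ℕ) : code (uncode i) = i := by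
  obtain ⟨p, rfl⟩ := exists_code_eq i
  rw [uncode_code]

theorem length_eq_iff (p : List Bool) (n : ℕ) :
    p.length = n ↔ 2 ^ n ≤ code p + 1 ∧ code p + 1 < 2 ^ (n + 1) := by
  refine ⟨fun h => h ▸ ⟨two_pow_length_le p, code_lt p⟩, fun ⟨h1, h2⟩ => ?_⟩
  have h3 := (Nat.pow_lt_pow_iff_right (a := 2) (by simp)).1 (h1.trans_lt (code_lt p))
  have h4 := (Nat.pow_lt_pow_iff_right (a := 2) (by simp)).1 ((two_pow_length_le p).trans_lt h2)
  omega

end AlgStat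

/-! ### The enumeration of uncovered strings as a prefix-free machine. -/

namespace AlgStat

open Finset

variable (Φ : Interpreter)

/-- `1` if the program `p` does not halt on `y` within `t` steps, and `0` otherwise. -/
def notHalted (t : ℕ) (p : List Bool) (y : List ℕ) : ℕ := if (Φ.run t p y).isSome then 0 else 1

/-- The output within `t` steps, empty if there is none. -/
def output (t : ℕ) (p : List Bool) (y : List ℕ) : List ℕ := (Φ.run t p y).getD []

/-- The number of those inputs needed for the use of `p` as a model of kind `z` on which `p` does
not halt within `t` steps. -/
def missing (z n t : ℕ) (p : List Bool) : ℕ :=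
  if z = 0 then notHalted Φ t p [n]
  else if z = 1 then ∑ j ∈ range (2 ^ n), notHalted Φ t p [2 ^ n + j - 1, n, n]
  else ∑ d ∈ range (2 ^ (n + 1) - 1), notHalted Φ t p [d, n]

/-- The weight, in units of `2⁻ⁿ`, that the model `p` of kind `z` assigns to the string with code
`i`. -/
def weight (z n t : ℕ) (p : List Bool) (i : ℕ) : ℕ :=
  if z = 0 then
    if i ∈ output Φ t p [n] then
      2 ^ n / ∑ j ∈ range (2 ^ n), if 2 ^ n + j - 1 ∈ output Φ t p [n] then 1 else 0
    else 0
  else if z = 1 then (output Φ t p [i, n, n]).headI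
  else ∑ d ∈ range (2 ^ (n + 1) - 1),
    if output Φ t p [d, n] = [i] then 2 ^ (n - (uncode d).length) else 0

/-- `p` is a model of kind `z` within `t` steps if this number is zero. -/
def pending (z n t : ℕ) (p : List Bool) : ℕ :=
  missing Φ z n t p + ((∑ j ∈ range (2 ^ n), weight Φ z n t p (2 ^ n + j - 1)) - 2 ^ (n + 1))

/-- `2 ^ t` times the total weight `2^{-l(p)}` of the models `p` with `lo ≤ l(p) < hi` that
appear after stage `s` and not after stage `t`. -/
def newWeight (lo hi n s t : ℕ) : ℕ :=
  ∑ c ∈ range (2 ^ (t + 1)), ∑ z ∈ range 3,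
    if (pending Φ z n t (uncode c) = 0 ∧ ¬ pending Φ z n s (uncode c) = 0) ∧
        lo ≤ (uncode c).length ∧ (uncode c).length < hi
    then 2 ^ (t - (uncode c).length) else 0

/-- The number of models within `t` steps of complexity at most `m` that give the string with
code `i` weight at least `2^{l(p) - m - 2}`. -/
def coverCount (m n t i : ℕ) : ℕ :=
  ∑ c ∈ range (2 ^ (t + 1)), ∑ z ∈ range 3,
    if pending Φ z n t (uncode c) = 0 ∧ (uncode c).length ≤ m ∧
        2 ^ n ≤ weight Φ z n t (uncode c) i * 2 ^ (m - (uncode c).length + 2)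
    then 1 else 0

variable (lo : ℕ → ℕ → ℕ) (e : ℕ → ℕ)

/-- The number of levels at which the window of latest entries of the history `l` does not allow a
new entry at stage `t`. -/
def blockCount (q t : ℕ) (l : List ℕ) : ℕ :=
  ∑ i ∈ range (2 ^ (e q + 4)),
    if 2 ^ (q - (lo q i + 3)) ≤ l.length ∧
      newWeight Φ (lo q i) (lo q (i + 1)) (4 * q) (l.getI (2 ^ (q - (lo q i + 3)) - 1)) t
        * 2 ^ (lo q i + 3 + e q) < 2 ^ t ∧
      newWeight Φ 0 (t + 1) (4 * q) (l.getI (2 ^ (q - (lo q i + 3)) - 1)) t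
        * 2 ^ (lo q i + 3) < 6 * 2 ^ t
    then 1 else 0

/-- The list of the stages not after `t` at which a new string is produced, latest first. -/
def history (q t : ℕ) : List ℕ :=
  Nat.rec [] (fun t l => if blockCount Φ lo e q t l = 0 then (t + 1) :: l else l) t

/-- The code, when shifted by one, of the `j`-th string of length `4q` with the prefix `u`. -/
def candidate (q : ℕ) (u : List Bool) (j : ℕ) : ℕ := (code u + 1) * 2 ^ (3 * q) + j - 1

/-- The machine that, given `4q`, maps strings `u` of length `q` to strings with the prefix `u`
that no model available at the stage of the `u`-th entry of the history covers. -/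
def producer : Machine := fun u y =>
  if u.length = y.headI / 4 then
    (Nat.rfind fun t => Part.some (decide
      (code u + 1 - 2 ^ (y.headI / 4) < (history Φ lo e (y.headI / 4) t).length))).bind fun t =>
    (Nat.rfind fun j => Part.some (decide
      (coverCount Φ (2 * (y.headI / 4)) (4 * (y.headI / 4)) t
        (candidate (y.headI / 4) u j) = 0))).map fun j => [candidate (y.headI / 4) u j]
  else Part.none

section Computability

variable {α : Type*} [Primcodable α] {z n t i m s lo' hi' q : α → ℕ} {p : α → List Bool}
  {y : α → List ℕ}

theorem computable_run (ht : Computable t) (hp : Computable p) (hy : Computable y) :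
    Computable fun a => Φ.run (t a) (p a) (y a) :=
  Φ.computable.comp (ht.pair (hp.pair hy))

theorem computable_notHalted (ht : Computable t) (hp : Computable p) (hy : Computable y) :
    Computable fun a => notHalted Φ (t a) (p a) (y a) :=
  ((Primrec.dom_bool fun b => if b then 0 else 1).to_comp.comp
    (Primrec.option_isSome.to_comp.comp (computable_run Φ ht hp hy))).of_eq fun _ => rfl

theorem computable_output (ht : Computable t) (hp : Computable p) (hy : Computable y) :
    Computable fun a => output Φ (t a) (p a) (y a) :=
  Computable.option_getD (computable_run Φ ht hp hy) (Computable.const [])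

theorem computable_singleton (hn : Computable n) : Computable fun a => [n a] :=
  Computable.list_cons.comp hn (Computable.const [])

theorem computable_pair (hi : Computable i) (hn : Computable n) : Computable fun a => [i a, n a] :=
  Computable.list_cons.comp hi (computable_singleton hn)

theorem computable_triple (hi : Computable i) (hm : Computable m) (hn : Computable n) :
    Computable fun a => [i a, m a, n a] :=
  Computable.list_cons.comp hi (computable_pair hm hn)

theorem computable_stringCode (hn : Computable n) (hi : Computable i) :
    Computable fun a => 2 ^ n a + i a - 1 :=
  computable_sub (computable_add (computable_two_pow hn) hi) (Computable.const 1)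

theorem computable_shortCodes (hn : Computable n) : Computable fun a => 2 ^ (n a + 1) - 1 :=
  computable_sub (computable_two_pow (computable_add hn (Computable.const 1))) (Computable.const 1)

theorem computable_missing (hz : Computable z) (hn : Computable n) (ht : Computable t)
    (hp : Computable p) : Computable fun a => missing Φ (z a) (n a) (t a) (p a) := by
  have hn' := hn.comp (Computable.fst (α := α) (β := ℕ))
  have ht' := ht.comp (Computable.fst (α := α) (β := ℕ))
  have hp' := hp.comp (Computable.fst (α := α) (β := ℕ))
  refine computable_ite (computable_decide_eq hz (Computable.const 0))
    (computable_notHalted Φ ht hp (computable_singleton hn))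
    (computable_ite (computable_decide_eq hz (Computable.const 1))
      (computable_sum_range (computable_two_pow hn) ?_)
      (computable_sum_range (computable_shortCodes hn) ?_))
  · exact computable_notHalted Φ ht' hp'
      (computable_triple (computable_stringCode hn' Computable.snd) hn' hn')
  · exact computable_notHalted Φ ht' hp' (computable_pair Computable.snd hn')

theorem computable_weight (hz : Computable z) (hn : Computable n) (ht : Computable t)
    (hp : Computable p) (hi : Computable i) :
    Computable fun a => weight Φ (z a) (n a) (t a) (p a) (i a) := by
  have hn' := hn.comp (Computable.fst (α := α) (β := ℕ))
  have ht' := ht.comp (Computable.fst (α := α) (β := ℕ))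
  have hp' := hp.comp (Computable.fst (α := α) (β := ℕ))
  have hi' := hi.comp (Computable.fst (α := α) (β := ℕ))
  refine computable_ite (computable_decide_eq hz (Computable.const 0))
    (computable_ite (computable_decide_mem hi (computable_output Φ ht hp (computable_singleton hn)))
      (computable_div (computable_two_pow hn) (computable_sum_range (computable_two_pow hn) ?_))
      (Computable.const 0))
    (computable_ite (computable_decide_eq hz (Computable.const 1))
      (Primrec.list_headI.to_comp.comp (computable_output Φ ht hp (computable_triple hi hn hn)))
      (computable_sum_range (computable_shortCodes hn) ?_))
  · exact computable_ite (computable_decide_mem (computable_stringCode hn' Computable.snd)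
      (computable_output Φ ht' hp' (computable_singleton hn'))) (Computable.const 1)
      (Computable.const 0)
  · exact computable_ite (computable_decide_eq (computable_output Φ ht' hp'
      (computable_pair Computable.snd hn')) (computable_singleton hi'))
      (computable_two_pow (computable_sub hn' (Computable.list_length.comp
        (primrec_uncode.to_comp.comp Computable.snd)))) (Computable.const 0)

theorem computable_pending (hz : Computable z) (hn : Computable n) (ht : Computable t)
    (hp : Computable p) : Computable fun a => pending Φ (z a) (n a) (t a) (p a) := by
  have hn' := hn.comp (Computable.fst (α := α) (β := ℕ))
  refine computable_add (computable_missing Φ hz hn ht hp) (computable_sub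
    (computable_sum_range (computable_two_pow hn) ?_)
    (computable_two_pow (computable_add hn (Computable.const 1))))
  exact computable_weight Φ (hz.comp Computable.fst) hn' (ht.comp Computable.fst)
    (hp.comp Computable.fst) (computable_stringCode hn' Computable.snd)

theorem computable_newWeight (hlo : Computable lo') (hhi : Computable hi') (hn : Computable n)
    (hs : Computable s) (ht : Computable t) :
    Computable fun a => newWeight Φ (lo' a) (hi' a) (n a) (s a) (t a) := by
  have h1 : Computable fun x : (α × ℕ) × ℕ => x.1.1 := Computable.fst.comp Computable.fst
  have hc : Computable fun x : (α × ℕ) × ℕ => uncode x.1.2 :=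
    primrec_uncode.to_comp.comp (Computable.snd.comp Computable.fst)
  have hl := Computable.list_length.comp hc
  refine computable_sum_range (computable_two_pow (computable_add ht (Computable.const 1)))
    (computable_sum_range (Computable.const 3) ?_)
  refine computable_ite (computable_decide_and (computable_decide_and
    (computable_decide_eq (computable_pending Φ Computable.snd (hn.comp h1) (ht.comp h1) hc)
      (Computable.const 0)) (computable_decide_not
    (computable_decide_eq (computable_pending Φ Computable.snd (hn.comp h1) (hs.comp h1) hc)
      (Computable.const 0)))) (computable_decide_and (computable_decide_le (hlo.comp h1) hl)
    (computable_decide_lt hl (hhi.comp h1)))) (computable_two_pow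
    (computable_sub (ht.comp h1) hl)) (Computable.const 0)

theorem computable_coverCount (hm : Computable m) (hn : Computable n) (ht : Computable t)
    (hi : Computable i) : Computable fun a => coverCount Φ (m a) (n a) (t a) (i a) := by
  have h1 : Computable fun x : (α × ℕ) × ℕ => x.1.1 := Computable.fst.comp Computable.fst
  have hc : Computable fun x : (α × ℕ) × ℕ => uncode x.1.2 :=
    primrec_uncode.to_comp.comp (Computable.snd.comp Computable.fst)
  have hl := Computable.list_length.comp hc
  refine computable_sum_range (computable_two_pow (computable_add ht (Computable.const 1)))
    (computable_sum_range (Computable.const 3) ?_)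
  exact computable_ite (computable_decide_and (computable_decide_eq
    (computable_pending Φ Computable.snd (hn.comp h1) (ht.comp h1) hc) (Computable.const 0))
    (computable_decide_and (computable_decide_le hl (hm.comp h1)) (computable_decide_le
    (computable_two_pow (hn.comp h1)) (computable_mul (computable_weight Φ Computable.snd
      (hn.comp h1) (ht.comp h1) hc (hi.comp h1)) (computable_two_pow (computable_add
      (computable_sub (hm.comp h1) hl) (Computable.const 2)))))))
    (Computable.const 1) (Computable.const 0)

variable {lo e}

theorem computable_blockCount (hlo : Computable₂ lo) (he : Computable e) {l : α → List ℕ}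
    (hq : Computable q) (ht : Computable t) (hl : Computable l) :
    Computable fun a => blockCount Φ lo e (q a) (t a) (l a) := by
  have hq' := hq.comp (Computable.fst (α := α) (β := ℕ))
  have ht' := ht.comp (Computable.fst (α := α) (β := ℕ))
  have hl' := hl.comp (Computable.fst (α := α) (β := ℕ))
  have h0 := hlo.comp hq' Computable.snd
  have h0' := hlo.comp hq' (computable_add Computable.snd (Computable.const 1))
  have hk := computable_add h0 (Computable.const 3)
  have hw := computable_two_pow (computable_sub hq' hk)
  have hn := computable_mul (Computable.const 4) hq'
  have hs := Primrec.list_getI.to_comp.comp hl' (computable_sub hw (Computable.const 1))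
  have h2t := computable_two_pow ht'
  refine computable_sum_range (computable_two_pow (computable_add (he.comp hq)
    (Computable.const 4))) ?_
  exact computable_ite (computable_decide_and (computable_decide_le hw
      (Computable.list_length.comp hl'))
    (computable_decide_and (computable_decide_lt (computable_mul
        (computable_newWeight Φ h0 h0' hn hs ht')
        (computable_two_pow (computable_add hk (he.comp hq')))) h2t)
      (computable_decide_lt (computable_mul
        (computable_newWeight Φ (Computable.const 0) (computable_add ht' (Computable.const 1))
          hn hs ht') (computable_two_pow hk)) (computable_mul (Computable.const 6) h2t))))
    (Computable.const 1) (Computable.const 0)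

theorem computable_history (hlo : Computable₂ lo) (he : Computable e)
    (hq : Computable q) (ht : Computable t) :
    Computable fun a => history Φ lo e (q a) (t a) := by
  refine Computable.nat_rec ht (Computable.const [])
    (h := fun a x => if blockCount Φ lo e (q a) x.1 x.2 = 0 then (x.1 + 1) :: x.2 else x.2) ?_
  have h1 : Computable fun x : α × ℕ × List ℕ => x.2.1 := Computable.fst.comp Computable.snd
  have h2 : Computable fun x : α × ℕ × List ℕ => x.2.2 := Computable.snd.comp Computable.snd
  exact computable_ite (computable_decide_eq (computable_blockCount Φ hlo he
    (hq.comp Computable.fst) h1 h2) (Computable.const 0))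
    (Computable.list_cons.comp (computable_add h1 (Computable.const 1)) h2) h2

theorem computable_candidate (hq : Computable q) (hp : Computable p) (hi : Computable i) :
    Computable fun a => candidate (q a) (p a) (i a) :=
  computable_sub (computable_add (computable_mul (computable_add (primrec_code.to_comp.comp hp)
    (Computable.const 1)) (computable_two_pow (computable_mul (Computable.const 3) hq))) hi)
    (Computable.const 1)

theorem partrec_ite {β σ : Type*} [Primcodable β] [Primcodable σ] {P : β → Prop} [DecidablePred P]
    (hP : Computable fun a => decide (P a)) {f : β →. σ} (hf : Partrec f) :
    Partrec fun a => if P a then f a else Part.none := by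
  have h : Computable fun a => if P a then some () else none :=
    computable_ite hP (Computable.const _) (Computable.const _)
  refine (Partrec.bind (Computable.ofOption h) (hf.comp Computable.fst).to₂).of_eq fun a => ?_
  by_cases hp : P a <;> simp [hp]

theorem partrec_producer (hlo : Computable₂ lo) (he : Computable e) :
    Partrec fun a : List Bool × List ℕ => producer Φ lo e a.1 a.2 := by
  have hq : Computable fun a : List Bool × List ℕ => a.2.headI / 4 :=
    computable_div (Primrec.list_headI.to_comp.comp Computable.snd) (Computable.const 4)
  refine partrec_ite (computable_decide_eq (Computable.list_length.comp Computable.fst) hq)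
    (Partrec.bind (Partrec.rfind (Computable.partrec ?_)) (Partrec.map (Partrec.rfind
      (Computable.partrec ?_)) ?_))
  · have hq' := hq.comp (Computable.fst (α := List Bool × List ℕ) (β := ℕ))
    exact computable_decide_lt (computable_sub (computable_add (primrec_code.to_comp.comp
      (Computable.fst.comp Computable.fst)) (Computable.const 1)) (computable_two_pow hq'))
      (Computable.list_length.comp (computable_history Φ hlo he hq' Computable.snd))
  · have h1 : Computable fun x : ((List Bool × List ℕ) × ℕ) × ℕ => x.1.1 :=
      Computable.fst.comp Computable.fst
    have hq' := hq.comp h1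
    exact computable_decide_eq (computable_coverCount Φ (computable_mul (Computable.const 2) hq')
      (computable_mul (Computable.const 4) hq') (Computable.snd.comp Computable.fst)
      (computable_candidate hq' (Computable.fst.comp h1) Computable.snd)) (Computable.const 0)
  · have h1 : Computable fun x : ((List Bool × List ℕ) × ℕ) × ℕ => x.1.1 :=
      Computable.fst.comp Computable.fst
    exact computable_singleton (computable_candidate (hq.comp h1) (Computable.fst.comp h1)
      Computable.snd)

end Computability

theorem prefixFree_producer : PrefixFree (producer Φ lo e) := by
  intro y p q hp hq hpq
  have key : ∀ u, (producer Φ lo e u y).Dom → u.length = y.headI / 4 := by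
    intro u hu
    by_contra h
    simp [producer, h] at hu
  exact hpq.eq_of_length ((key p hp).trans (key q hq).symm)

end AlgStat

/-! ### Kraft's inequality, the mass of models, and the number of strings they cover. -/

namespace AlgStat

open Finset

/-- **Kraft's inequality** for prefix-free sets of binary strings. -/
theorem kraft_inequality {S : Finset (List Bool)} (hS : ∀ p ∈ S, ∀ q ∈ S, p <+: q → p = q) :
    ∑ p ∈ S, (1 / 2 : ℝ) ^ p.length ≤ 1 := by
  -- The empty word is the only obstacle to unique decodability of a prefix-free set, and a
  -- prefix-free set that contains it is a singleton.
  by_cases h0 : [] ∈ S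
  · have : S = {[]} := by
      ext p
      refine ⟨fun hp => ?_, fun hp => (mem_singleton.1 hp) ▸ h0⟩
      exact mem_singleton.2 (hS _ h0 _ hp List.nil_prefix).symm
    simp [this]
  · have hU : InformationTheory.UniquelyDecodable (S : Set (List Bool)) := by
      intro L₁
      induction L₁ with
      | nil =>
        intro L₂ _ h2 h
        cases L₂ with
        | nil => rfl
        | cons b L₂ =>
          have hb : b = [] := by
            have : [] = b ++ L₂.flatten := by simpa using h
            exact (List.append_eq_nil_iff.1 this.symm).1
          exact absurd (hb ▸ h2 b (by simp)) h0
      | cons a L₁ ih =>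
        intro L₂ h1 h2 h
        cases L₂ with
        | nil =>
          have ha : a = [] := by
            have : a ++ L₁.flatten = [] := by simpa using h
            exact (List.append_eq_nil_iff.1 this).1
          exact absurd (ha ▸ h1 a (by simp)) h0
        | cons b L₂ =>
          simp only [List.flatten_cons] at h
          have ha : a ∈ S := h1 a (by simp)
          have hb : b ∈ S := h2 b (by simp)
          have hab : a = b := by
            rcases List.prefix_or_prefix_of_prefix (l₃ := a ++ L₁.flatten) (List.prefix_append _ _)
              (h ▸ List.prefix_append _ _ : b <+: a ++ L₁.flatten) with h' | h'
            · exact hS _ ha _ hb h'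
            · exact (hS _ hb _ ha h').symm
          subst hab
          rw [ih L₂ (fun w hw => h1 w (by simp [hw])) (fun w hw => h2 w (by simp [hw]))
            (List.append_cancel_left h)]
    simpa using InformationTheory.kraft_mcmillan_inequality hU

variable (Φ : Interpreter)

/-- An input on which every model of the kind `z` halts. -/
def probe (z n : ℕ) : List ℕ :=
  if z = 0 then [n] else if z = 1 then [2 ^ n - 1, n, n] else [0, n]

/-- The models that are available at stage `t`, with their kinds. -/
def models (n t : ℕ) : Finset (ℕ × List Bool) :=
  (range 3 ×ˢ (range (2 ^ (t + 1))).image uncode).filter fun m => pending Φ m.1 n t m.2 = 0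

/-- The total weight of a set of models. -/
noncomputable def mass (S : Finset (ℕ × List Bool)) : ℝ := ∑ m ∈ S, (1 / 2 : ℝ) ^ m.2.length

theorem mass_mono {S T : Finset (ℕ × List Bool)} (h : S ⊆ T) : mass S ≤ mass T :=
  sum_le_sum_of_subset_of_nonneg h fun _ _ _ => by positivity

theorem mass_nonneg (S : Finset (ℕ × List Bool)) : 0 ≤ mass S :=
  sum_nonneg fun _ _ => by positivity

variable {Φ} {z n t t' : ℕ} {p : List Bool}

theorem notHalted_eq_zero {y : List ℕ} : notHalted Φ t p y = 0 ↔ ∃ w, Φ.run t p y = some w := by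
  rw [← Option.isSome_iff_exists]
  unfold notHalted
  split_ifs with h <;> simp [h]

theorem run_eq_of_le {y : List ℕ} (h : notHalted Φ t p y = 0) (htt : t ≤ t') :
    Φ.run t' p y = Φ.run t p y := by
  obtain ⟨w, hw⟩ := notHalted_eq_zero.1 h
  rw [hw, Φ.mono htt hw]

theorem notHalted_of_le {y : List ℕ} (h : notHalted Φ t p y = 0) (htt : t ≤ t') :
    notHalted Φ t' p y = 0 := by
  unfold notHalted at *
  rwa [run_eq_of_le h htt]

theorem output_eq_of_le {y : List ℕ} (h : notHalted Φ t p y = 0) (htt : t ≤ t') :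
    output Φ t' p y = output Φ t p y := by
  unfold output
  rw [run_eq_of_le h htt]

theorem missing_of_le (h : missing Φ z n t p = 0) (htt : t ≤ t') : missing Φ z n t' p = 0 := by
  unfold missing at *
  split_ifs at * with h0 h1
  · exact notHalted_of_le h htt
  · exact sum_eq_zero fun j hj => notHalted_of_le (sum_eq_zero_iff.1 h j hj) htt
  · exact sum_eq_zero fun j hj => notHalted_of_le (sum_eq_zero_iff.1 h j hj) htt

theorem weight_eq_of_le (h : missing Φ z n t p = 0) (htt : t ≤ t') {j : ℕ} (hj : j < 2 ^ n) :
    weight Φ z n t' p (2 ^ n + j - 1) = weight Φ z n t p (2 ^ n + j - 1) := by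
  unfold missing weight at *
  split_ifs at h with h0 h1
  · simp only [h0, if_true, output_eq_of_le h htt]
  · simp only [h1, if_true, one_ne_zero, if_false]
    rw [output_eq_of_le (sum_eq_zero_iff.1 h j (mem_range.2 hj)) htt]
  · simp only [h0, h1, if_false]
    exact sum_congr rfl fun d hd => by rw [output_eq_of_le (sum_eq_zero_iff.1 h d hd) htt]

/-- All outputs that the definition of a model refers to are already given, and outputs never
change; so the weights are frozen once a model is available. -/
theorem pending_of_le (h : pending Φ z n t p = 0) (htt : t ≤ t') : pending Φ z n t' p = 0 := by
  unfold pending at *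
  obtain ⟨h1, h2⟩ := Nat.add_eq_zero_iff.1 h
  rw [missing_of_le h1 htt, sum_congr rfl fun j hj => weight_eq_of_le h1 htt (mem_range.1 hj), h2]

theorem missing_of_pending (h : pending Φ z n t p = 0) : missing Φ z n t p = 0 :=
  (Nat.add_eq_zero_iff.1 h).1

theorem sum_weight_le (h : pending Φ z n t p = 0) :
    ∑ j ∈ range (2 ^ n), weight Φ z n t p (2 ^ n + j - 1) ≤ 2 ^ (n + 1) :=
  Nat.sub_eq_zero_iff_le.1 (Nat.add_eq_zero_iff.1 h).2

theorem probe_halted (h : pending Φ z n t p = 0) : notHalted Φ t p (probe z n) = 0 := by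
  have h := missing_of_pending h
  unfold missing at h
  unfold probe
  split_ifs at * with h0 h1
  · exact h
  · simpa using sum_eq_zero_iff.1 h 0 (by simp)
  · refine sum_eq_zero_iff.1 h 0 (mem_range.2 ?_)
    have : 2 ^ 1 ≤ 2 ^ (n + 1) := Nat.pow_le_pow_right (by simp) (by omega)
    omega

theorem length_le_of_pending (h : pending Φ z n t p = 0) : p.length ≤ t := by
  obtain ⟨w, hw⟩ := notHalted_eq_zero.1 (probe_halted h)
  exact Φ.length_le hw

theorem mem_models {m : ℕ × List Bool} :
    m ∈ models Φ n t ↔ m.1 < 3 ∧ pending Φ m.1 n t m.2 = 0 := by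
  simp only [models, mem_filter, mem_product, mem_range, mem_image]
  refine ⟨fun h => ⟨h.1.1, h.2⟩, fun h => ⟨⟨h.1, code m.2, ?_, uncode_code _⟩, h.2⟩⟩
  have := code_lt m.2
  have h2 : 2 ^ (m.2.length + 1) ≤ 2 ^ (t + 1) :=
    Nat.pow_le_pow_right (by simp) (by have := length_le_of_pending h.2; omega)
  omega

theorem models_mono (h : t ≤ t') : models Φ n t ⊆ models Φ n t' := fun m hm => by
  rw [mem_models] at *
  exact ⟨hm.1, pending_of_le hm.2 h⟩

/-- Models of one kind all halt on a common input, the probe, so they form a prefix-free set and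
Kraft's inequality gives mass at most 1 for each of the three kinds. -/
theorem mass_le_of_dom (hΦ : PrefixFree Φ.eval) (S : Finset (ℕ × List Bool))
    (hS : ∀ m ∈ S, m.1 < 3 ∧ (Φ.eval m.2 (probe m.1 n)).Dom) : mass S ≤ 3 := by
  unfold mass
  rw [← sum_fiberwise_of_maps_to (t := range 3) (g := Prod.fst)
    fun m hm => mem_range.2 (hS m hm).1]
  calc ∑ z ∈ range 3, ∑ m ∈ S with m.1 = z, (1 / 2 : ℝ) ^ m.2.length
      ≤ ∑ z ∈ range 3, 1 := by
        refine sum_le_sum fun z _ => ?_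
        have hinj : Set.InjOn Prod.snd (S.filter fun m => m.1 = z : Set (ℕ × List Bool)) := by
          intro m hm m' hm' h
          simp only [coe_filter, Set.mem_ofPred_eq] at hm hm'
          exact Prod.ext (hm.2.trans hm'.2.symm) h
        rw [← sum_image (f := fun p : List Bool => (1 / 2 : ℝ) ^ p.length) hinj]
        refine kraft_inequality fun p hp q hq hpq => ?_
        have key : ∀ r ∈ (S.filter fun m => m.1 = z).image Prod.snd,
            (Φ.eval r (probe z n)).Dom := by
          intro r hr
          obtain ⟨m, hm, rfl⟩ := mem_image.1 hr
          obtain ⟨hm', rfl⟩ := mem_filter.1 hm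
          exact (hS m hm').2
        exact hΦ _ p q (key p hp) (key q hq) hpq
    _ = 3 := by simp

theorem dom_of_pending (h : pending Φ z n t p = 0) : (Φ.eval p (probe z n)).Dom := by
  obtain ⟨w, hw⟩ := notHalted_eq_zero.1 (probe_halted h)
  exact Part.dom_iff_mem.2 ⟨w, Φ.mem_eval.2 ⟨t, hw⟩⟩

theorem mass_models_le (hΦ : PrefixFree Φ.eval) : mass (models Φ n t) ≤ 3 :=
  mass_le_of_dom hΦ _ fun _ hm => ⟨(mem_models.1 hm).1, dom_of_pending (mem_models.1 hm).2⟩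

/-- The models that appear after stage `s` and not after stage `t`. -/
def newModels (Φ : Interpreter) (n s t : ℕ) : Finset (ℕ × List Bool) := models Φ n t \ models Φ n s

theorem sum_models (n t : ℕ) (f : ℕ × List Bool → ℕ) :
    ∑ m ∈ models Φ n t, f m = ∑ c ∈ range (2 ^ (t + 1)), ∑ z ∈ range 3,
      if pending Φ z n t (uncode c) = 0 then f (z, uncode c) else 0 := by
  rw [models, sum_filter, sum_product_right, sum_image]
  exact fun a _ b _ h => by rw [← code_uncode a, h, code_uncode]

/-- Models available at stage t have length at most t, so scaling by 2^t makes all masses integers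
and the comparisons in the enumeration decidable. -/
theorem newWeight_eq (lo hi s : ℕ) : (newWeight Φ lo hi n s t : ℝ) =
    2 ^ t * mass ((newModels Φ n s t).filter fun m => lo ≤ m.2.length ∧ m.2.length < hi) := by
  have h1 : newWeight Φ lo hi n s t = ∑ m ∈ models Φ n t,
      if m ∉ models Φ n s ∧ lo ≤ m.2.length ∧ m.2.length < hi then 2 ^ (t - m.2.length) else 0 := by
    rw [sum_models]
    refine sum_congr rfl fun c _ => sum_congr rfl fun z hz => ?_
    have : (z, uncode c) ∈ models Φ n s ↔ pending Φ z n s (uncode c) = 0 := by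
      rw [mem_models]; exact and_iff_right (mem_range.1 hz)
    simp only [this]
    by_cases h : pending Φ z n t (uncode c) = 0 <;> simp [h]
  have h2 : (newModels Φ n s t).filter (fun m => lo ≤ m.2.length ∧ m.2.length < hi) =
      (models Φ n t).filter fun m => m ∉ models Φ n s ∧ lo ≤ m.2.length ∧ m.2.length < hi := by
    ext m; simp only [newModels, mem_filter, mem_sdiff, and_assoc]
  rw [h1, mass, h2, ← sum_filter, mul_sum, Nat.cast_sum]
  refine sum_congr rfl fun m hm => ?_
  have hl := length_le_of_pending (mem_models.1 (mem_filter.1 hm).1).2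
  rw [Nat.cast_pow, Nat.cast_ofNat, pow_sub₀ _ two_ne_zero hl, one_div, inv_pow]

/-- The weight of the string with code `i` in the model `m` is at least `2^{-L-2}`. -/
def Covers (Φ : Interpreter) (n t : ℕ) (m : ℕ × List Bool) (L i : ℕ) : Prop :=
  2 ^ n ≤ weight Φ m.1 n t m.2 i * 2 ^ (L + 2)

instance (n t : ℕ) (m : ℕ × List Bool) (L : ℕ) : DecidablePred (Covers Φ n t m L) :=
  fun _ => inferInstanceAs (Decidable (_ ≤ _))

theorem Covers.mono {m : ℕ × List Bool} {L L' i : ℕ} (h : Covers Φ n t m L i) (hL : L ≤ L') :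
    Covers Φ n t m L' i :=
  le_trans (b := weight Φ m.1 n t m.2 i * 2 ^ (L + 2)) h
    (Nat.mul_le_mul_left _ (Nat.pow_le_pow_right (by simp) (by omega)))

theorem Covers.of_le {m : ℕ × List Bool} {L j : ℕ} (hm : m ∈ models Φ n t) (hj : j < 2 ^ n)
    (htt : t ≤ t') : Covers Φ n t' m L (2 ^ n + j - 1) ↔ Covers Φ n t m L (2 ^ n + j - 1) := by
  unfold Covers
  rw [weight_eq_of_le (missing_of_pending (mem_models.1 hm).2) htt hj]

/-- Markov's inequality: the weights, in units of 2^{-n}, sum to at most 2^{n+1}, and each covered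
string takes at least 2^{n-L-2}. -/
theorem card_covers_le {m : ℕ × List Bool} (hm : m ∈ models Φ n t) (L : ℕ) :
    ((range (2 ^ n)).filter fun j => Covers Φ n t m L (2 ^ n + j - 1)).card ≤ 2 ^ (L + 3) := by
  have h := sum_weight_le (mem_models.1 hm).2
  have h1 : ((range (2 ^ n)).filter fun j => Covers Φ n t m L (2 ^ n + j - 1)).card * 2 ^ n ≤
      2 ^ (n + 1) * 2 ^ (L + 2) := by
    calc _ ≤ ∑ j ∈ (range (2 ^ n)).filter fun j => Covers Φ n t m L (2 ^ n + j - 1),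
          weight Φ m.1 n t m.2 (2 ^ n + j - 1) * 2 ^ (L + 2) := by
          rw [← smul_eq_mul]
          exact card_nsmul_le_sum _ _ _ fun j hj => (mem_filter.1 hj).2
      _ ≤ ∑ j ∈ range (2 ^ n), weight Φ m.1 n t m.2 (2 ^ n + j - 1) * 2 ^ (L + 2) :=
          sum_le_sum_of_subset (filter_subset _ _)
      _ ≤ _ := by rw [← sum_mul]; exact Nat.mul_le_mul_right _ h
  refine Nat.le_of_mul_le_mul_right (h1.trans (le_of_eq ?_)) (pow_pos (by simp : 0 < 2) n)
  ring

theorem coverCount_eq (M i : ℕ) : coverCount Φ M n t i =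
    ((models Φ n t).filter fun m => m.2.length ≤ M ∧ Covers Φ n t m (M - m.2.length) i).card := by
  rw [card_filter, sum_models]
  refine sum_congr rfl fun c _ => sum_congr rfl fun z _ => ?_
  by_cases h : pending Φ z n t (uncode c) = 0
  · simp only [h, true_and, if_true, Covers]
    congr
  · simp [h]

/-- A family of models of complexity at most `M` covers few strings. -/
theorem card_covered_le (S : Finset (ℕ × List Bool)) (hS : S ⊆ models Φ n t) (M : ℕ)
    (hM : ∀ m ∈ S, m.2.length ≤ M) :
    (((range (2 ^ n)).filter fun j =>
      ∃ m ∈ S, Covers Φ n t m (M - m.2.length) (2 ^ n + j - 1)).card : ℝ) ≤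
      2 ^ (M + 3) * mass S := by
  have h : (range (2 ^ n)).filter (fun j =>
      ∃ m ∈ S, Covers Φ n t m (M - m.2.length) (2 ^ n + j - 1)) ⊆ S.biUnion fun m =>
      (range (2 ^ n)).filter fun j => Covers Φ n t m (M - m.2.length) (2 ^ n + j - 1) := by
    intro j hj
    obtain ⟨h1, m, hm, h2⟩ := mem_filter.1 hj
    exact mem_biUnion.2 ⟨m, hm, mem_filter.2 ⟨h1, h2⟩⟩
  calc _ ≤ ((∑ m ∈ S, 2 ^ (M - m.2.length + 3) : ℕ) : ℝ) := by
        refine Nat.cast_le.2 ((card_le_card h).trans (card_biUnion_le.trans ?_))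
        exact sum_le_sum fun m hm => card_covers_le (hS hm) _
    _ = _ := by
        rw [mass, mul_sum, Nat.cast_sum]
        refine sum_congr rfl fun m hm => ?_
        have h3 : M + 3 = M - m.2.length + 3 + m.2.length := by have := hM m hm; omega
        rw [h3, pow_add _ _ m.2.length, mul_assoc, ← mul_pow]
        simp

end AlgStat

/-! ### The history of the enumeration: why it stops, and a window that stays quiet. -/

namespace AlgStat

open Finset

variable {Φ : Interpreter} {lo : ℕ → ℕ → ℕ} {e : ℕ → ℕ} {q : ℕ}

/-- The models in `S` with complexity in `[a, b)`. -/
def ofLength (a b : ℕ) (S : Finset (ℕ × List Bool)) : Finset (ℕ × List Bool) :=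
  S.filter fun m => a ≤ m.2.length ∧ m.2.length < b

theorem ofLength_mono {a b : ℕ} {S T : Finset (ℕ × List Bool)} (h : S ⊆ T) :
    ofLength a b S ⊆ ofLength a b T := filter_subset_filter _ h

theorem newModels_mono {n s t s' t' : ℕ} (hs : s' ≤ s) (ht : t ≤ t') :
    newModels Φ n s t ⊆ newModels Φ n s' t' := sdiff_subset_sdiff (models_mono ht) (models_mono hs)

theorem mass_newModels {n s t : ℕ} (h : s ≤ t) :
    mass (newModels Φ n s t) = mass (models Φ n t) - mass (models Φ n s) :=
  eq_sub_of_add_eq (sum_sdiff (models_mono h))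

theorem mass_ofLength_newModels {n s t a b : ℕ} (h : s ≤ t) :
    mass (ofLength a b (newModels Φ n s t)) =
      mass (ofLength a b (models Φ n t)) - mass (ofLength a b (models Φ n s)) := by
  refine eq_sub_of_add_eq ?_
  have : ofLength a b (newModels Φ n s t) =
      ofLength a b (models Φ n t) \ ofLength a b (models Φ n s) := by
    ext m; simp only [ofLength, newModels, mem_filter, mem_sdiff]; tauto
  rw [this]
  exact sum_sdiff (ofLength_mono (models_mono h))

/-- At level `i`, few models appear after stage `s` and not after stage `t`. -/
def Quiet (Φ : Interpreter) (lo : ℕ → ℕ → ℕ) (e : ℕ → ℕ) (q i s t : ℕ) : Prop :=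
  mass (ofLength (lo q i) (lo q (i + 1)) (newModels Φ (4 * q) s t)) * 2 ^ (lo q i + 3 + e q) < 1 ∧
    mass (newModels Φ (4 * q) s t) * 2 ^ (lo q i + 3) < 6

theorem Quiet.mono {i s s' t t' : ℕ} (h : Quiet Φ lo e q i s t) (hs : s ≤ s') (ht : t' ≤ t) :
    Quiet Φ lo e q i s' t' :=
  ⟨(mul_le_mul_of_nonneg_right (mass_mono (ofLength_mono (newModels_mono hs ht)))
    (by positivity)).trans_lt h.1,
    (mul_le_mul_of_nonneg_right (mass_mono (newModels_mono hs ht)) (by positivity)).trans_lt h.2⟩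

/-- The length of the window at level `i`. -/
def window (lo : ℕ → ℕ → ℕ) (q i : ℕ) : ℕ := 2 ^ (q - (lo q i + 3))

theorem blockCount_ne_zero {t : ℕ} {l : List ℕ} : blockCount Φ lo e q t l ≠ 0 ↔
    ∃ i < 2 ^ (e q + 4), window lo q i ≤ l.length ∧
      Quiet Φ lo e q i (l.getI (window lo q i - 1)) t := by
  have h2 : (0 : ℝ) < 2 ^ t := by positivity
  have key : ∀ i, (newWeight Φ (lo q i) (lo q (i + 1)) (4 * q)
        (l.getI (2 ^ (q - (lo q i + 3)) - 1)) t * 2 ^ (lo q i + 3 + e q) < 2 ^ t ∧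
      newWeight Φ 0 (t + 1) (4 * q) (l.getI (2 ^ (q - (lo q i + 3)) - 1)) t
        * 2 ^ (lo q i + 3) < 6 * 2 ^ t) ↔ Quiet Φ lo e q i (l.getI (window lo q i - 1)) t := by
    intro i
    refine and_congr ?_ ?_
    · rw [← Nat.cast_lt (α := ℝ), Nat.cast_mul, newWeight_eq]
      push_cast
      rw [mul_assoc, mul_lt_iff_lt_one_right h2]
      rfl
    · rw [← Nat.cast_lt (α := ℝ), Nat.cast_mul, newWeight_eq]
      push_cast
      -- The length range from 0 to t + 1 is no restriction, since models at stage t have length at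
      -- most t.
      rw [mul_assoc, mul_comm (6 : ℝ), mul_lt_mul_iff_right₀ h2, filter_true_of_mem]
      · rfl
      · intro m hm
        have := length_le_of_pending (mem_models.1 (mem_sdiff.1 hm).1).2
        omega
  rw [blockCount, Ne, sum_eq_zero_iff]
  push Not
  simp only [key, mem_range]
  refine exists_congr fun i => and_congr_right fun _ => ?_
  unfold window
  unfold window at key
  split_ifs with h <;> simp [h, ← key]

theorem history_zero : history Φ lo e q 0 = [] := rfl

theorem history_succ (t : ℕ) : history Φ lo e q (t + 1) =
    if blockCount Φ lo e q t (history Φ lo e q t) = 0 then (t + 1) :: history Φ lo e q t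
    else history Φ lo e q t := rfl

theorem length_history_mono : Monotone fun t => (history Φ lo e q t).length :=
  monotone_nat_of_le_succ fun t => by
    simp only [history_succ]
    split_ifs <;> simp

/-- Entries are recorded as the stages at which they were added, so the tail that starts with an
entry is the history at that very stage. -/
theorem history_eq_of_append {t s : ℕ} {l₁ l₂ : List ℕ}
    (h : history Φ lo e q t = l₁ ++ s :: l₂) : s ≤ t ∧ history Φ lo e q s = s :: l₂ := by
  induction t generalizing l₁ with
  | zero => simp [history_zero] at h
  | succ t ih =>
    by_cases h0 : blockCount Φ lo e q t (history Φ lo e q t) = 0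
    · rw [history_succ, if_pos h0] at h
      cases l₁ with
      | nil =>
        obtain ⟨rfl, rfl⟩ := List.cons_eq_cons.1 h
        exact ⟨le_rfl, by rw [history_succ, if_pos h0]⟩
      | cons a l₁ => exact (ih (List.cons_eq_cons.1 h).2).imp (fun h => h.trans (by simp)) id
    · rw [history_succ, if_neg h0] at h
      exact (ih h).imp (fun h => h.trans (by simp)) id

theorem history_getI {t j : ℕ} (hj : j < (history Φ lo e q t).length) :
    (history Φ lo e q t).getI j ≤ t ∧
      history Φ lo e q ((history Φ lo e q t).getI j) = (history Φ lo e q t).drop j := by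
  have h : history Φ lo e q t = (history Φ lo e q t).take j ++
      (history Φ lo e q t).getI j :: (history Φ lo e q t).drop (j + 1) := by
    conv_lhs => rw [← List.take_append_drop j (history Φ lo e q t)]
    rw [List.drop_eq_getElem_cons hj, List.getI_eq_getElem _ hj]
  refine (history_eq_of_append h).imp id fun h2 => h2.trans ?_
  rw [List.drop_eq_getElem_cons hj, List.getI_eq_getElem _ hj]

theorem length_history_getI {t j : ℕ} (hj : j < (history Φ lo e q t).length) :
    (history Φ lo e q ((history Φ lo e q t).getI j)).length =
      (history Φ lo e q t).length - j := by
  rw [(history_getI hj).2, List.length_drop]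

/-- Stage `s` is the stage of the entry number `v` of the history. -/
def EntryAt (Φ : Interpreter) (lo : ℕ → ℕ → ℕ) (e : ℕ → ℕ) (q v s : ℕ) : Prop :=
  ∃ r, s = r + 1 ∧ (history Φ lo e q r).length = v ∧
    history Φ lo e q s = s :: history Φ lo e q r ∧
    blockCount Φ lo e q r (history Φ lo e q r) = 0

theorem entryAt_getI {t j : ℕ} (hj : j < (history Φ lo e q t).length) :
    EntryAt Φ lo e q ((history Φ lo e q t).length - 1 - j) ((history Φ lo e q t).getI j) := by
  have h2 := (history_getI hj).2
  have hl := length_history_getI hj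
  rw [List.drop_eq_getElem_cons hj] at h2
  rw [← List.getI_eq_getElem _ hj] at h2
  generalize (history Φ lo e q t).getI j = s at *
  cases s with
  | zero => simp [history_zero] at h2
  | succ r =>
    by_cases h0 : blockCount Φ lo e q r (history Φ lo e q r) = 0
    · have h3 := h2
      rw [history_succ, if_pos h0] at h3
      refine ⟨r, rfl, ?_, by rw [h2, (List.cons_eq_cons.1 h3).2], h0⟩
      rw [h2] at hl
      rw [(List.cons_eq_cons.1 h3).2]
      simp only [List.length_cons] at hl
      omega
    · rw [history_succ, if_neg h0] at h2
      have := (history_eq_of_append (l₁ := []) h2).1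
      omega

theorem EntryAt.unique {v s s' : ℕ} (h : EntryAt Φ lo e q v s) (h' : EntryAt Φ lo e q v s') :
    s = s' := by
  have key : ∀ {s s'}, EntryAt Φ lo e q v s → EntryAt Φ lo e q v s' → s' ≤ s := by
    rintro s s' ⟨r, rfl, hr, h, -⟩ ⟨r', rfl, hr', h', -⟩
    by_contra hlt
    have h3 := length_history_mono (Φ := Φ) (lo := lo) (e := e) (q := q)
      (show r + 1 ≤ r' by omega)
    simp only [h, List.length_cons] at h3
    omega
  exact le_antisymm (key h' h) (key h h')

theorem EntryAt.le_of_lt_length {v s t : ℕ} (h : EntryAt Φ lo e q v s)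
    (ht : v < (history Φ lo e q t).length) : s ≤ t := by
  obtain ⟨r, rfl, hr, -, -⟩ := h
  by_contra hlt
  have h3 := length_history_mono (Φ := Φ) (lo := lo) (e := e) (q := q) (show t ≤ r by omega)
  simp only at h3
  omega

theorem EntryAt.stage_le {v v' s s' : ℕ} (h : EntryAt Φ lo e q v s) (h' : EntryAt Φ lo e q v' s')
    (hv : v ≤ v') : s ≤ s' := by
  refine h.le_of_lt_length ?_
  obtain ⟨r, rfl, hr, h2, -⟩ := h'
  rw [h2, List.length_cons]
  omega

/-- When the later entry was admitted, the earlier one was the oldest in the window of level i, and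
that level did not block. -/
theorem not_quiet_of_entryAt {v s s' i : ℕ} (hi : i < 2 ^ (e q + 4))
    (h : EntryAt Φ lo e q v s) (h' : EntryAt Φ lo e q (v + window lo q i) s') :
    ¬ Quiet Φ lo e q i s s' := by
  intro hQ
  have hw : 0 < window lo q i := by unfold window; positivity
  obtain ⟨r, rfl, hr, h2, h3⟩ := h'
  refine blockCount_ne_zero.2 ⟨i, hi, by omega, ?_⟩ h3
  have hE := entryAt_getI (Φ := Φ) (lo := lo) (e := e) (q := q) (t := r)
    (j := window lo q i - 1) (by omega)
  have : (history Φ lo e q r).length - 1 - (window lo q i - 1) = v := by omega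
  rw [this] at hE
  rw [← h.unique hE]
  exact hQ.mono le_rfl (by omega)

theorem sum_mass_ofLength_le (hlo : Monotone (lo q)) (S : Finset (ℕ × List Bool)) (N : ℕ) :
    ∑ i ∈ range N, mass (ofLength (lo q i) (lo q (i + 1)) S) ≤ mass S := by
  unfold mass
  rw [← sum_biUnion]
  · exact mass_mono (biUnion_subset.2 fun i _ => filter_subset _ _)
  · have key : ∀ i j, i < j → Disjoint (ofLength (lo q i) (lo q (i + 1)) S)
        (ofLength (lo q j) (lo q (j + 1)) S) := by
      intro i j hij
      refine disjoint_left.2 fun m h1 h2 => ?_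
      have h3 := (mem_filter.1 h1).2.2
      have h4 := (mem_filter.1 h2).2.1
      have := hlo (show i + 1 ≤ j by omega)
      omega
    intro i _ j _ hij
    rcases lt_or_gt_of_ne hij with h | h
    · exact key i j h
    · exact (key j i h).symm

/-- If on each of `K - 1` steps either `x` increases by `1 / (K * E)` or `y` increases by `6 / K`,
while `y` remains at most `3`, then `x` becomes large. -/
theorem le_of_forall_step {K : ℕ} {E B : ℝ} {x y : ℕ → ℝ} (hK : 8 ≤ K) (hE : 0 ≤ E)
    (hx : ∀ j < K - 1, x j ≤ x (j + 1)) (hy : ∀ j < K - 1, y j ≤ y (j + 1))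
    (hx0 : 0 ≤ x 0) (hy0 : 0 ≤ y 0) (hxB : x (K - 1) ≤ B) (hy3 : y (K - 1) ≤ 3)
    (hstep : ∀ j < K - 1, 1 ≤ (x (j + 1) - x j) * (K * E) ∨ 6 ≤ (y (j + 1) - y j) * K) :
    3 / 8 ≤ E * B := by
  have hK' : (8 : ℝ) ≤ K := by exact_mod_cast hK
  -- The potential K·E·x + (K/6)·y grows by at least 1 per step. It ends at no more than K·E·B +
  -- K/2, and K - 1 - K/2 ≥ 3K/8 because K ≥ 8.
  have h1 : ∀ j ∈ range (K - 1), (1 : ℝ) ≤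
      (K * E * x (j + 1) + K / 6 * y (j + 1)) - (K * E * x j + K / 6 * y j) := by
    intro j hj
    have hj := mem_range.1 hj
    have p1 : 0 ≤ (x (j + 1) - x j) * (K * E) :=
      mul_nonneg (sub_nonneg.2 (hx j hj)) (by positivity)
    have p2 : 0 ≤ (y (j + 1) - y j) * K := mul_nonneg (sub_nonneg.2 (hy j hj)) (by positivity)
    have h3 : (K * E * x (j + 1) + K / 6 * y (j + 1)) - (K * E * x j + K / 6 * y j) =
      (x (j + 1) - x j) * (K * E) + (y (j + 1) - y j) * K / 6 := by ring
    rw [h3]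
    rcases hstep j hj with h | h <;> linarith
  have h2 := sum_le_sum h1
  rw [sum_range_sub (f := fun j => K * E * x j + K / 6 * y j), sum_const, card_range, nsmul_eq_mul,
    mul_one, Nat.cast_sub (by omega), Nat.cast_one] at h2
  have h3 : (0 : ℝ) ≤ K * E * x 0 + K / 6 * y 0 := by positivity
  have h4 : (K : ℝ) * E * x (K - 1) ≤ K * E * B := mul_le_mul_of_nonneg_left hxB (by positivity)
  have h5 : (K : ℝ) / 6 * y (K - 1) ≤ K / 6 * 3 := mul_le_mul_of_nonneg_left hy3 (by positivity)
  have h6 : (K : ℝ) * (3 / 8) ≤ K * (E * B) := by linarith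
  exact le_of_mul_le_mul_left h6 (by linarith)

theorem exists_entryAt {v t : ℕ} (hv : v < (history Φ lo e q t).length) :
    ∃ s, EntryAt Φ lo e q v s := by
  have := entryAt_getI (Φ := Φ) (lo := lo) (e := e) (q := q) (t := t)
    (j := (history Φ lo e q t).length - 1 - v) (by omega)
  rw [Nat.sub_sub_self (by omega)] at this
  exact ⟨_, this⟩

/-- A history of 2^q entries splits into 2^{lo_i+3} consecutive windows, none of them quiet from its
start to the start of the next. Since the total mass is at most 3, only about half of them can be
disturbed by a gain of total mass; the others each bring new mass to level i. -/
theorem le_mass_level (hΦ : PrefixFree Φ.eval) {i t : ℕ} (hi : i < 2 ^ (e q + 4))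
    (hq : lo q i + 3 ≤ q) (hlen : 2 ^ q ≤ (history Φ lo e q t).length) :
    (3 / 8 : ℝ) ≤ 2 ^ e q * mass (ofLength (lo q i) (lo q (i + 1)) (models Φ (4 * q) t)) := by
  have hex : ∀ v, ∃ s, v < 2 ^ q → EntryAt Φ lo e q v s := by
    intro v
    by_cases hv : v < 2 ^ q
    · exact (exists_entryAt (hv.trans_le hlen)).imp fun s hs _ => hs
    · exact ⟨0, fun h => absurd h hv⟩
  choose T hT using hex
  have hw : window lo q i * 2 ^ (lo q i + 3) = 2 ^ q := by
    rw [window, ← pow_add, Nat.sub_add_cancel hq]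
  have hw0 : 0 < window lo q i := by rw [window]; positivity
  have hlt : ∀ j, j < 2 ^ (lo q i + 3) → j * window lo q i < 2 ^ q := fun j hj => by
    rw [← hw, mul_comm (window lo q i)]; exact Nat.mul_lt_mul_of_pos_right hj hw0
  have hpos : 0 < 2 ^ (lo q i + 3) := by positivity
  have hTle : ∀ j < 2 ^ (lo q i + 3) - 1, T (j * window lo q i) ≤ T ((j + 1) * window lo q i) :=
    fun j hj => (hT _ (hlt j (by omega))).stage_le (hT _ (hlt (j + 1) (by omega)))
      (Nat.mul_le_mul_right _ (by omega))
  have hend := hlt (2 ^ (lo q i + 3) - 1) (Nat.sub_lt hpos one_pos)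
  refine le_of_forall_step (K := 2 ^ (lo q i + 3))
    (x := fun j => mass (ofLength (lo q i) (lo q (i + 1))
      (models Φ (4 * q) (T (j * window lo q i)))))
    (y := fun j => mass (models Φ (4 * q) (T (j * window lo q i)))) ?_ (by positivity)
    (fun j hj => mass_mono (ofLength_mono (models_mono (hTle j hj))))
    (fun j hj => mass_mono (models_mono (hTle j hj))) (mass_nonneg _) (mass_nonneg _)
    (mass_mono (ofLength_mono (models_mono ((hT _ hend).le_of_lt_length (hend.trans_le hlen)))))
    (mass_models_le hΦ) ?_
  · exact (by norm_num : 8 = 2 ^ 3).le.trans (Nat.pow_le_pow_right (by simp) (by omega))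
  · intro j hj
    have h2 := hT _ (hlt (j + 1) (by omega))
    have h3 := not_quiet_of_entryAt hi (hT _ (hlt j (by omega))) (s' := T ((j + 1) * window lo q i))
      (by rw [add_mul, one_mul] at h2 ⊢; exact h2)
    rw [Quiet, not_and_or, not_lt, not_lt, mass_ofLength_newModels (hTle j hj),
      mass_newModels (hTle j hj), pow_add _ _ (e q)] at h3
    push_cast
    exact h3

/-- The levels occupy disjoint ranges of complexity, so their masses add up: 2^{e+4} levels with
(3/8)·2^{-e} each would give 6, against the bound 3. -/
theorem length_history_lt (hΦ : PrefixFree Φ.eval) (hlo : Monotone (lo q))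
    (hq : ∀ i < 2 ^ (e q + 4), lo q i + 3 ≤ q) (t : ℕ) :
    (history Φ lo e q t).length < 2 ^ q := by
  by_contra! hlen
  have h1 := sum_le_sum fun i (hi : i ∈ range (2 ^ (e q + 4))) =>
    le_mass_level (lo := lo) hΦ (mem_range.1 hi) (hq i (mem_range.1 hi)) hlen
  rw [sum_const, card_range, nsmul_eq_mul, ← mul_sum] at h1
  have h2 := sum_mass_ofLength_le hlo (models Φ (4 * q) t) (2 ^ (e q + 4))
  have h3 := mass_models_le (n := 4 * q) (t := t) hΦ
  have h4 : (0 : ℝ) < 2 ^ e q := by positivity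
  have h5 := mul_le_mul_of_nonneg_left (h2.trans h3) h4.le
  push_cast at h1
  rw [pow_add] at h1
  linarith

/-- The process comes to rest, and at some level the window of the latest entries remains quiet. -/
theorem exists_quiet_window (hΦ : PrefixFree Φ.eval) (hlo : Monotone (lo q))
    (hq : ∀ i < 2 ^ (e q + 4), lo q i + 3 ≤ q) :
    ∃ i < 2 ^ (e q + 4), ∃ v₀ s : ℕ, v₀ + window lo q i < 2 ^ q ∧
      (∃ t, v₀ + window lo q i ≤ (history Φ lo e q t).length) ∧
      (∀ t, v₀ < (history Φ lo e q t).length → s ≤ t) ∧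
      ∀ t, Quiet Φ lo e q i s t := by
  obtain ⟨t₀, ht₀⟩ : ∃ t₀, ∀ t, (history Φ lo e q t).length ≤ (history Φ lo e q t₀).length := by
    have hfin : (Set.range fun t => (history Φ lo e q t).length).Finite :=
      (Set.finite_lt_nat (2 ^ q)).subset (by
        rintro _ ⟨t, rfl⟩; exact length_history_lt hΦ hlo hq t)
    obtain ⟨_, ⟨⟨t₀, rfl⟩, h⟩⟩ := hfin.exists_maximal (Set.range_nonempty _)
    refine ⟨t₀, fun t => ?_⟩
    by_contra! hlt
    exact absurd (h (Set.mem_range_self t) hlt.le) (not_le.2 hlt)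
  have hconst : ∀ t, t₀ ≤ t → history Φ lo e q t = history Φ lo e q t₀ := by
    intro t ht
    induction t, ht using Nat.le_induction with
    | base => rfl
    | succ t ht ih =>
      have h1 := ht₀ (t + 1)
      rw [history_succ] at h1 ⊢
      split_ifs at * with h0
      · simp only [List.length_cons, ih] at h1
        omega
      · exact ih
  set l := history Φ lo e q t₀ with hl₀
  obtain ⟨i, hi, hil, hQ⟩ : ∃ i < 2 ^ (e q + 4), window lo q i ≤ l.length ∧
      ∀ t, Quiet Φ lo e q i (l.getI (window lo q i - 1)) t := by
    -- Quietness only gets lost as time passes. If every full window were disturbed at some stage,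
    -- then none of the finitely many levels would block after all these stages, and a further entry
    -- would follow.
    by_contra! hcon
    have hex : ∀ i, ∃ t, i < 2 ^ (e q + 4) → window lo q i ≤ l.length →
        ¬ Quiet Φ lo e q i (l.getI (window lo q i - 1)) t := by
      intro i
      by_cases h : i < 2 ^ (e q + 4) ∧ window lo q i ≤ l.length
      · obtain ⟨t, ht⟩ := hcon i h.1 h.2
        exact ⟨t, fun _ _ => ht⟩
      · exact ⟨0, fun h1 h2 => absurd ⟨h1, h2⟩ h⟩
    choose T hT using hex
    set t := max t₀ ((range (2 ^ (e q + 4))).sup T)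
    have hb : blockCount Φ lo e q t (history Φ lo e q t) ≠ 0 := by
      intro h0
      have h1 := ht₀ (t + 1)
      rw [history_succ, if_pos h0, hconst t (le_max_left _ _), List.length_cons] at h1
      omega
    rw [hconst t (le_max_left _ _)] at hb
    obtain ⟨i, hi, h1, h2⟩ := blockCount_ne_zero.1 hb
    refine hT i hi h1 (h2.mono le_rfl ?_)
    exact (le_sup (f := T) (mem_range.2 hi)).trans (le_max_right _ _)
  have hw : 0 < window lo q i := by unfold window; positivity
  have hl := length_history_lt hΦ hlo hq t₀
  rw [← hl₀] at hl
  -- The start of the window is entry number v₀ = `l.length - window lo q i`; as the history lists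
  -- the latest entry first, its stage stands at index `window lo q i - 1`.
  refine ⟨i, hi, l.length - window lo q i, l.getI (window lo q i - 1), by omega,
    ⟨t₀, by rw [← hl₀]; omega⟩, fun t ht => EntryAt.le_of_lt_length ?_ ht, hQ⟩
  have h := entryAt_getI (Φ := Φ) (lo := lo) (e := e) (q := q) (t := t₀)
    (j := window lo q i - 1) (by rw [← hl₀]; omega)
  rwa [← hl₀, Nat.sub_sub, Nat.add_sub_cancel' hw] at h

end AlgStat

/-! ### Existence of uncovered strings, and statistics as models. -/

namespace AlgStat

open Finset

variable {Φ : Interpreter} {lo : ℕ → ℕ → ℕ} {e : ℕ → ℕ} {q n t : ℕ} {p x : List Bool}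

theorem exists_index (hx : x.length = n) : ∃ j < 2 ^ n, code x = 2 ^ n + j - 1 := by
  obtain ⟨h1, h2⟩ := (length_eq_iff x n).1 hx
  rw [pow_succ] at h2
  exact ⟨code x + 1 - 2 ^ n, by omega, by omega⟩

theorem length_uncode_index {j : ℕ} (hj : j < 2 ^ n) : (uncode (2 ^ n + j - 1)).length = n := by
  rw [length_eq_iff, code_uncode, pow_succ]
  omega

/-- Given `4q`, the producer outputs, for every entry of the history, a string that is not covered by
any model available at that stage. -/
theorem exists_mem_producer (hΦ : PrefixFree Φ.eval) (hq : 5 ≤ q) {v t₀ : ℕ} (hv : v < 2 ^ q)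
    (ht₀ : v < (history Φ lo e q t₀).length) :
    ∃ t j, v < (history Φ lo e q t).length ∧ j < 2 ^ (4 * q) ∧ j / 2 ^ (3 * q) = v ∧
      [2 ^ (4 * q) + j - 1] ∈ producer Φ lo e (uncode (2 ^ q + v - 1)) [4 * q] ∧
      ∀ m ∈ models Φ (4 * q) t, m.2.length ≤ 2 * q →
        ¬ Covers Φ (4 * q) t m (2 * q - m.2.length) (2 ^ (4 * q) + j - 1) := by
  have hlen := length_uncode_index hv
  have hcode : code (uncode (2 ^ q + v - 1)) + 1 = 2 ^ q + v := by
    have : 0 < 2 ^ q := by positivity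
    rw [code_uncode]; omega
  have hcand : ∀ j, candidate q (uncode (2 ^ q + v - 1)) j =
      2 ^ (4 * q) + (v * 2 ^ (3 * q) + j) - 1 := by
    intro j
    rw [candidate, hcode, add_mul, ← pow_add]
    ring_nf
  obtain ⟨t, ht, -⟩ := Nat.rfind_min' (p := fun t => decide (v < (history Φ lo e q t).length))
    (by simpa using ht₀)
  have hvt : v < (history Φ lo e q t).length := by
    have := Nat.rfind_spec ht
    simpa using this
  -- Models of complexity at most 2q cover at most 3·2^{2q+3} strings, fewer than the 2^{3q}
  -- extensions of the prefix when q ≥ 5. The prefix keeps the strings of different entries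
  -- distinct.
  obtain ⟨j₀, hj₀, hj₀'⟩ : ∃ j < 2 ^ (3 * q),
      coverCount Φ (2 * q) (4 * q) t (candidate q (uncode (2 ^ q + v - 1)) j) = 0 := by
    by_contra! hcon
    set S := (models Φ (4 * q) t).filter fun m => m.2.length ≤ 2 * q with hS
    have h1 := card_covered_le S (filter_subset _ _) (2 * q) fun m hm => (mem_filter.1 hm).2
    have h2 : mass S ≤ 3 := (mass_mono (filter_subset _ _)).trans (mass_models_le hΦ)
    have h3 : 2 ^ (3 * q) ≤ ((range (2 ^ (4 * q))).filter fun j => ∃ m ∈ S,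
        Covers Φ (4 * q) t m (2 * q - m.2.length) (2 ^ (4 * q) + j - 1)).card := by
      rw [← card_range (2 ^ (3 * q))]
      refine card_le_card_of_injOn (fun j => v * 2 ^ (3 * q) + j) ?_ ?_
      · intro j hj
        have hj := mem_range.1 hj
        rw [mem_coe, mem_filter, mem_range]
        refine ⟨?_, ?_⟩
        · calc v * 2 ^ (3 * q) + j < (v + 1) * 2 ^ (3 * q) := by rw [add_mul]; omega
            _ ≤ 2 ^ q * 2 ^ (3 * q) := Nat.mul_le_mul_right _ hv
            _ = 2 ^ (4 * q) := by rw [← pow_add]; ring_nf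
        · have h4 := hcon j hj
          rw [coverCount_eq, Ne, card_eq_zero, filter_eq_empty_iff] at h4
          push Not at h4
          obtain ⟨m, hm, hml, hmc⟩ := h4
          exact ⟨m, mem_filter.2 ⟨hm, hml⟩, by rwa [hcand] at hmc⟩
      · intro a _ b _ h
        exact Nat.add_left_cancel h
    have h4 : (2 : ℝ) ^ (3 * q) ≤ 2 ^ (2 * q + 3) * 3 := by
      refine le_trans ?_ (h1.trans (mul_le_mul_of_nonneg_left h2 (by positivity)))
      exact_mod_cast h3
    have h5 : (2 : ℝ) ^ (2 * q + 5) ≤ 2 ^ (3 * q) :=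
      pow_le_pow_right₀ (by norm_num) (by omega)
    have h6 : (0 : ℝ) < 2 ^ (2 * q) := by positivity
    rw [pow_add] at h4 h5
    linarith
  obtain ⟨j, hj, hjle⟩ := Nat.rfind_min' (p := fun j => decide (coverCount Φ (2 * q) (4 * q) t
    (candidate q (uncode (2 ^ q + v - 1)) j) = 0)) (by simpa using hj₀')
  have hjc : coverCount Φ (2 * q) (4 * q) t (candidate q (uncode (2 ^ q + v - 1)) j) = 0 := by
    have := Nat.rfind_spec hj
    simpa using this
  have hdiv : (v * 2 ^ (3 * q) + j) / 2 ^ (3 * q) = v := by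
    rw [mul_comm, Nat.mul_add_div (by positivity), Nat.div_eq_of_lt (by omega), add_zero]
  refine ⟨t, v * 2 ^ (3 * q) + j, hvt, ?_, hdiv, ?_, ?_⟩
  · calc v * 2 ^ (3 * q) + j < (v + 1) * 2 ^ (3 * q) := by rw [add_mul]; omega
      _ ≤ 2 ^ q * 2 ^ (3 * q) := Nat.mul_le_mul_right _ hv
      _ = 2 ^ (4 * q) := by rw [← pow_add]; ring_nf
  · have h4 : ([4 * q] : List ℕ).headI / 4 = q := by simp
    have hc2 : code (uncode (2 ^ q + v - 1)) + 1 - 2 ^ q = v := by omega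
    rw [producer, h4, if_pos hlen, hc2]
    refine Part.mem_bind ht ?_
    rw [← hcand]
    exact Part.mem_map _ hj
  · intro m hm hml hmc
    rw [coverCount_eq, card_eq_zero, filter_eq_empty_iff] at hjc
    exact hjc hm ⟨hml, by rwa [hcand]⟩

theorem exists_stage (p : List Bool) (s : Finset (List ℕ)) (f : List ℕ → List ℕ)
    (h : ∀ y ∈ s, f y ∈ Φ.eval p y) : ∃ t, ∀ y ∈ s, Φ.run t p y = some (f y) := by
  have hex : ∀ y, ∃ t, y ∈ s → Φ.run t p y = some (f y) := by
    intro y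
    by_cases hy : y ∈ s
    · exact (Φ.mem_eval.1 (h y hy)).imp fun _ ht _ => ht
    · exact ⟨0, fun h => absurd h hy⟩
  choose T hT using hex
  exact ⟨s.sup T, fun y hy => Φ.mono (le_sup hy) (hT y hy)⟩

theorem notHalted_of_run {y w : List ℕ} (h : Φ.run t p y = some w) : notHalted Φ t p y = 0 :=
  notHalted_eq_zero.2 ⟨w, h⟩

theorem output_of_run {y w : List ℕ} (h : Φ.run t p y = some w) : output Φ t p y = w := by
  simp [output, h]

/-- Halting on [n] is all that is needed: the weight is shared equally, rounded down, among the
listed strings of length n, so the total never exceeds 1. In particular, programs for strings of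
length n are models. -/
theorem mem_models_of_set {w : List ℕ} (h : Φ.run t p [n] = some w) :
    (0, p) ∈ models Φ n t := by
  rw [mem_models, pending, Nat.add_eq_zero_iff, Nat.sub_eq_zero_iff_le]
  refine ⟨by simp, by simpa [missing] using notHalted_of_run h, ?_⟩
  have h1 : ∑ j ∈ range (2 ^ n), weight Φ 0 n t p (2 ^ n + j - 1) =
      (∑ j ∈ range (2 ^ n), if 2 ^ n + j - 1 ∈ w then 1 else 0) *
      (2 ^ n / ∑ j ∈ range (2 ^ n), if 2 ^ n + j - 1 ∈ w then 1 else 0) := by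
    rw [sum_mul]
    refine sum_congr rfl fun j _ => ?_
    simp only [weight, if_true, output_of_run h, ite_mul, one_mul, zero_mul]
  rw [h1]
  exact (Nat.mul_div_le _ _).trans (Nat.pow_le_pow_right (by simp) (by simp))

theorem covers_of_set {L : List (List Bool)} {l : ℕ} (h : Φ.run t p [n] = some (L.map code))
    (hx : x.length = n) (hxL : x ∈ L) (hl : L.toFinset.card ≤ 2 ^ l) :
    Covers Φ n t (0, p) l (code x) := by
  set C := ∑ j ∈ range (2 ^ n), if 2 ^ n + j - 1 ∈ L.map code then 1 else 0 with hC
  have hC' : C = ((range (2 ^ n)).filter fun j => 2 ^ n + j - 1 ∈ L.map code).card := by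
    rw [hC, card_filter]
  have h2n : 0 < 2 ^ n := by positivity
  have h1 : C ≤ L.toFinset.card := by
    rw [hC']
    refine card_le_card_of_injOn (fun j => uncode (2 ^ n + j - 1)) ?_ ?_
    · intro j hj
      rw [mem_coe, mem_filter, List.mem_map] at hj
      obtain ⟨-, y, hy, hyj⟩ := hj
      rw [mem_coe, List.mem_toFinset]
      simp only
      rwa [← hyj, uncode_code]
    · intro a _ b _ hab
      have := congrArg code hab
      simp only [code_uncode] at this
      omega
  have h2 : 1 ≤ C := by
    obtain ⟨j, hj, hjx⟩ := exists_index hx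
    rw [hC', Nat.one_le_iff_ne_zero, Ne, card_eq_zero]
    exact ne_empty_of_mem (mem_filter.2 ⟨mem_range.2 hj, hjx ▸ List.mem_map_of_mem hxL⟩)
  have h3 : C ≤ 2 ^ n := by
    rw [hC']
    exact (card_filter_le _ _).trans (card_range _).le
  have h4 : weight Φ 0 n t p (code x) = 2 ^ n / C := by
    simp only [weight, if_true, output_of_run h, List.mem_map_of_mem hxL, hC]
  have h5 := Nat.lt_mul_div_succ (2 ^ n) h2
  have h6 : 1 ≤ 2 ^ n / C := (Nat.one_le_div_iff h2).2 h3
  unfold Covers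
  rw [h4]
  calc 2 ^ n ≤ C * (2 ^ n / C + 1) := h5.le
    _ ≤ 2 ^ l * (2 ^ n / C * 4) := Nat.mul_le_mul (h1.trans hl) (by omega)
    _ = 2 ^ n / C * 2 ^ (l + 2) := by ring

theorem covers_of_run (h : Φ.run t p [n] = some [code x]) (hx : x.length = n) :
    Covers Φ n t (0, p) 0 (code x) :=
  covers_of_set (L := [x]) (by simpa using h) hx (by simp) (by simp)

theorem sum_index_eq (f : List Bool → ℝ) (n : ℕ) :
    ∑ j ∈ range (2 ^ n), f (uncode (2 ^ n + j - 1)) = ∑ v : Fin n → Bool, f (List.ofFn v) := by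
  symm
  have h2 : 0 < 2 ^ n := by positivity
  refine sum_bij (fun v _ => code (List.ofFn v) + 1 - 2 ^ n) ?_ ?_ ?_ ?_
  · intro v _
    obtain ⟨h3, h4⟩ := (length_eq_iff (List.ofFn v) n).1 (by simp)
    rw [pow_succ] at h4
    exact mem_range.2 (by omega)
  · intro v _ v' _ h
    have h3 := ((length_eq_iff (List.ofFn v) n).1 (by simp)).1
    have h3' := ((length_eq_iff (List.ofFn v') n).1 (by simp)).1
    exact List.ofFn_injective (code_injective (by omega))
  · intro j hj
    have hl := length_uncode_index (mem_range.1 hj)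
    refine ⟨fun i => (uncode (2 ^ n + j - 1)).get (i.cast hl.symm), mem_univ _, ?_⟩
    have : List.ofFn (fun i : Fin n => (uncode (2 ^ n + j - 1)).get (i.cast hl.symm)) =
        uncode (2 ^ n + j - 1) := by
      rw [List.ofFn_congr hl.symm]
      simp
    rw [this, code_uncode]
    omega
  · intro v _
    have h3 := ((length_eq_iff (List.ofFn v) n).1 (by simp)).1
    rw [show 2 ^ n + (code (List.ofFn v) + 1 - 2 ^ n) - 1 = code (List.ofFn v) by omega,
      uncode_code]

/-- The semimeasure is evaluated at precision 2^{-n}. The errors on 2^n strings add at most 1 to the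
total, hence the bound 2^{n+1} on the weights of a model. The condition l < n keeps the weight of x
from being rounded to zero. -/
theorem exists_covers_of_prob {P : List Bool → ℝ} {l : ℕ} (hP : IsSemimeasure P)
    (hp : ComputesReal Φ n p P) (hx : x.length = n) (hl : l < n) (hxl : (1 / 2 : ℝ) ^ l ≤ P x) :
    ∃ t, (1, p) ∈ models Φ n t ∧ Covers Φ n t (1, p) l (code x) := by
  have h1 : ∀ i, ∃ r : ℕ, [r] ∈ Φ.eval p [i, n, n] ∧
      |P (uncode i) - (r : ℝ) / 2 ^ n| ≤ 1 / 2 ^ n := by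
    intro i
    have := hp (uncode i) n
    rwa [code_uncode] at this
  choose r hr hrP using h1
  obtain ⟨t, ht⟩ := exists_stage (Φ := Φ) p
    ((range (2 ^ n)).image fun j => [2 ^ n + j - 1, n, n]) (fun y => [r y.headI]) (by
      intro y hy
      obtain ⟨j, -, rfl⟩ := mem_image.1 hy
      exact hr _)
  have ht' : ∀ j ∈ range (2 ^ n), Φ.run t p [2 ^ n + j - 1, n, n] = some [r (2 ^ n + j - 1)] :=
    fun j hj => ht _ (mem_image_of_mem _ hj)
  have hw : ∀ j ∈ range (2 ^ n), weight Φ 1 n t p (2 ^ n + j - 1) = r (2 ^ n + j - 1) := by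
    intro j hj
    simp [weight, output_of_run (ht' j hj)]
  have h2n : (0 : ℝ) < 2 ^ n := by positivity
  have hr1 : ∀ i, (r i : ℝ) ≤ 2 ^ n * P (uncode i) + 1 := by
    intro i
    have h3 := (abs_le.1 (hrP i)).1
    have h4 : (r i : ℝ) / 2 ^ n ≤ P (uncode i) + 1 / 2 ^ n := by linarith
    rw [div_le_iff₀ h2n] at h4
    calc (r i : ℝ) ≤ _ := h4
      _ = _ := by field_simp
  have hr2 : ∀ i, 2 ^ n * P (uncode i) - 1 ≤ (r i : ℝ) := by
    intro i
    have h3 := (abs_le.1 (hrP i)).2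
    have h4 : P (uncode i) - 1 / 2 ^ n ≤ (r i : ℝ) / 2 ^ n := by linarith
    rw [le_div_iff₀ h2n] at h4
    calc _ = (P (uncode i) - 1 / 2 ^ n) * 2 ^ n := by field_simp
      _ ≤ (r i : ℝ) := h4
  refine ⟨t, ?_, ?_⟩
  · rw [mem_models, pending, Nat.add_eq_zero_iff, Nat.sub_eq_zero_iff_le]
    refine ⟨by simp, ?_, ?_⟩
    · simp only [missing, one_ne_zero, if_false, if_true]
      exact sum_eq_zero fun j hj => notHalted_of_run (ht' j hj)
    · rw [sum_congr rfl hw]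
      have h3 : ((∑ j ∈ range (2 ^ n), r (2 ^ n + j - 1) : ℕ) : ℝ) ≤ (2 ^ (n + 1) : ℕ) := by
        push_cast
        calc ∑ j ∈ range (2 ^ n), (r (2 ^ n + j - 1) : ℝ)
            ≤ ∑ j ∈ range (2 ^ n), (2 ^ n * P (uncode (2 ^ n + j - 1)) + 1) :=
              sum_le_sum fun j _ => hr1 _
          _ = 2 ^ n * ∑ v : Fin n → Bool, P (List.ofFn v) + 2 ^ n := by
              rw [sum_add_distrib, ← mul_sum, sum_index_eq]; simp
          _ ≤ 2 ^ n * 1 + 2 ^ n := by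
              have := mul_le_mul_of_nonneg_left (hP.2 n) h2n.le
              linarith
          _ = 2 ^ (n + 1) := by ring
      exact_mod_cast h3
  · obtain ⟨j, hj, hjx⟩ := exists_index hx
    unfold Covers
    have h3 : weight Φ 1 n t p (code x) = r (code x) := by
      rw [hjx]; exact hw j (mem_range.2 hj)
    rw [h3]
    have h4 := hr2 (code x)
    rw [uncode_code] at h4
    obtain ⟨d, rfl⟩ : ∃ d, n = l + d + 1 := ⟨n - l - 1, by omega⟩
    have h5 : (2 : ℝ) ^ (d + 1) ≤ 2 ^ (l + d + 1) * P x := by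
      have := mul_le_mul_of_nonneg_left hxl h2n.le
      refine le_trans (le_of_eq ?_) this
      rw [show l + d + 1 = d + 1 + l by ring, pow_add _ (d + 1), mul_assoc, ← mul_pow]
      simp
    have h6 : (2 : ℝ) ^ (d + 1) ≤ r (code x) + 1 := by linarith
    -- As 2^{d+1} ≥ 2, the rounding error of one unit costs no more than a factor 2, which the
    -- factor 4 in `Covers` absorbs.
    have h7 : 2 ^ (d + 1) ≤ r (code x) + 1 := by exact_mod_cast h6
    have h8 : 2 ^ (d + 1) ≤ r (code x) * 4 := by
      have : 2 ≤ 2 ^ (d + 1) := by rw [pow_succ]; have : 0 < 2 ^ d := by positivity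
                                   omega
      omega
    calc 2 ^ (l + d + 1) = 2 ^ (d + 1) * 2 ^ l := by ring
      _ ≤ r (code x) * 4 * 2 ^ l := Nat.mul_le_mul_right _ h8
      _ = _ := by ring

/-- The weight of a string is the probability that F produces it from random bits; only arguments of
length at most n, those with code below 2^{n+1} - 1, are inspected. Kraft's inequality on the domain
of F bounds the total. -/
theorem exists_covers_of_fun {F : List Bool → Option (List Bool)} {d : List Bool} {l : ℕ}
    (hF : PrefixFreeFun F) (hp : ComputesFun Φ n p F) (hd : F d = some x) (hl : l ≤ n)
    (hdl : d.length ≤ l) :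
    ∃ t, (2, p) ∈ models Φ n t ∧ Covers Φ n t (2, p) l (code x) := by
  obtain ⟨t, ht⟩ := exists_stage (Φ := Φ) p ((range (2 ^ (n + 1) - 1)).image fun d => [d, n])
    (fun y => ((F (uncode y.headI)).map code).toList) (by
      intro y hy
      obtain ⟨j, -, rfl⟩ := mem_image.1 hy
      have := hp (uncode j)
      rwa [code_uncode] at this)
  have ht' : ∀ c ∈ range (2 ^ (n + 1) - 1),
      Φ.run t p [c, n] = some ((F (uncode c)).map code).toList :=
    fun c hc => ht _ (mem_image_of_mem _ hc)
  have hw : ∀ i, weight Φ 2 n t p i = ∑ c ∈ range (2 ^ (n + 1) - 1),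
      if (F (uncode c)).map code = some i then 2 ^ (n - (uncode c).length) else 0 := by
    intro i
    simp only [weight, OfNat.ofNat_ne_zero, OfNat.ofNat_ne_one, if_false]
    refine sum_congr rfl fun c hc => ?_
    rw [output_of_run (ht' c hc)]
    refine if_congr ?_ rfl rfl
    cases (F (uncode c)).map code <;> simp
  refine ⟨t, ?_, ?_⟩
  · rw [mem_models, pending, Nat.add_eq_zero_iff, Nat.sub_eq_zero_iff_le]
    refine ⟨by simp, ?_, ?_⟩
    · simp only [missing, OfNat.ofNat_ne_zero, OfNat.ofNat_ne_one, if_false]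
      exact sum_eq_zero fun j hj => notHalted_of_run (ht' j hj)
    · rw [sum_congr rfl fun j _ => hw _, sum_comm]
      set D := ((range (2 ^ (n + 1) - 1)).image uncode).filter fun d => (F d).isSome with hD
      have hinj : Set.InjOn uncode (range (2 ^ (n + 1) - 1)) := fun a _ b _ h => by
        rw [← code_uncode a, h, code_uncode]
      have hDl : ∀ d ∈ D, d.length ≤ n := by
        intro d hd
        obtain ⟨c, hc, rfl⟩ := mem_image.1 (mem_filter.1 hd).1
        have h1 := two_pow_length_le (uncode c)
        rw [code_uncode] at h1
        have h2 := mem_range.1 hc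
        have := (Nat.pow_lt_pow_iff_right (a := 2) (by simp)).1
          (show 2 ^ (uncode c).length < 2 ^ (n + 1) by omega)
        omega
      have hK : ∑ d ∈ D, (1 / 2 : ℝ) ^ d.length ≤ 1 := kraft_inequality fun a ha b hb hab =>
        hF a b (mem_filter.1 ha).2 (mem_filter.1 hb).2 hab
      have h1 : ∀ c ∈ range (2 ^ (n + 1) - 1), (∑ j ∈ range (2 ^ n),
          if (F (uncode c)).map code = some (2 ^ n + j - 1) then 2 ^ (n - (uncode c).length)
          else 0) ≤ if (F (uncode c)).isSome then 2 ^ (n - (uncode c).length) else 0 := by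
        intro c _
        cases hFc : F (uncode c) with
        | none => simp
        | some y =>
          have h2 : 0 < 2 ^ n := by positivity
          simp only [Option.map_some, Option.some.injEq, Option.isSome_some, if_true]
          rw [sum_ite, sum_const_zero, add_zero, sum_const, smul_eq_mul]
          refine (Nat.mul_le_mul_right _ (card_le_one.2 ?_)).trans (one_mul _).le
          intro a ha b hb
          have ha := (mem_filter.1 ha).2
          have hb := (mem_filter.1 hb).2
          omega
      have h2 : ((∑ d ∈ D, 2 ^ (n - d.length) : ℕ) : ℝ) ≤ (2 ^ n : ℕ) := by
        calc ((∑ d ∈ D, 2 ^ (n - d.length) : ℕ) : ℝ)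
            = 2 ^ n * ∑ d ∈ D, (1 / 2 : ℝ) ^ d.length := by
              rw [mul_sum, Nat.cast_sum]
              refine sum_congr rfl fun d hd => ?_
              rw [Nat.cast_pow, Nat.cast_ofNat, pow_sub₀ _ two_ne_zero (hDl d hd), one_div, inv_pow]
          _ ≤ 2 ^ n * 1 := by gcongr
          _ = _ := by simp
      calc _ ≤ ∑ c ∈ range (2 ^ (n + 1) - 1),
            if (F (uncode c)).isSome then 2 ^ (n - (uncode c).length) else 0 := sum_le_sum h1
        _ = ∑ d ∈ D, 2 ^ (n - d.length) := by rw [hD, sum_filter, sum_image hinj]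
        _ ≤ 2 ^ n := by exact_mod_cast h2
        _ ≤ _ := Nat.pow_le_pow_right (by simp) (by simp)
  · unfold Covers
    rw [hw]
    have hdc : code d ∈ range (2 ^ (n + 1) - 1) := by
      have h1 := code_lt d
      have h2 : 2 ^ (d.length + 1) ≤ 2 ^ (n + 1) := Nat.pow_le_pow_right (by simp) (by omega)
      exact mem_range.2 (by omega)
    have h1 : 2 ^ (n - d.length) ≤ ∑ c ∈ range (2 ^ (n + 1) - 1),
        if (F (uncode c)).map code = some (code x) then 2 ^ (n - (uncode c).length) else 0 := by
      refine le_trans (le_of_eq ?_) (single_le_sum (fun _ _ => Nat.zero_le _) hdc)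
      simp [uncode_code, hd]
    calc 2 ^ n ≤ 2 ^ (n - d.length) * 2 ^ (l + 2) := by
          rw [← pow_add]; exact Nat.pow_le_pow_right (by simp) (by omega)
      _ ≤ _ := Nat.mul_le_mul_right _ h1

end AlgStat

/-! ### From bounds on models to lower bounds for minimal sufficient statistics. -/

namespace AlgStat

open Finset

variable {Φ : Interpreter} {q n : ℕ}

/-- Some model of complexity `j ≤ A` gives the string with code `i` weight at least
`2^{j - A - 2}`. -/
def Realized (Φ : Interpreter) (n i j A : ℕ) : Prop :=
  j ≤ A ∧ ∃ t, ∃ m ∈ models Φ n t, m.2.length = j ∧ Covers Φ n t m (A - j) i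

theorem Realized.mono {i j A A' : ℕ} (h : Realized Φ n i j A) (hA : A ≤ A') :
    Realized Φ n i j A' := by
  obtain ⟨hj, t, m, hm, hl, hc⟩ := h
  exact ⟨hj.trans hA, t, m, hm, hl, hc.mono (Nat.sub_le_sub_right hA j)⟩

/-- Among strings not covered at stage `s`, few are covered by models that appear later. -/
theorem card_realized_le {A s : ℕ} {β : ℝ} (P : ℕ → Prop) [DecidablePred P] (B : Finset ℕ)
    (J : ℕ → ℕ) (hA : A ≤ 2 * q) (hJ : Set.InjOn J B) (hlt : ∀ v ∈ B, J v < 2 ^ (4 * q))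
    (hnc : ∀ v ∈ B, ∃ t, s ≤ t ∧ ∀ m ∈ models Φ (4 * q) t, m.2.length ≤ 2 * q →
      ¬ Covers Φ (4 * q) t m (2 * q - m.2.length) (2 ^ (4 * q) + J v - 1))
    (hβ : ∀ t, mass ((newModels Φ (4 * q) s t).filter fun m => P m.2.length) ≤ β)
    (hB : ∀ v ∈ B, ∃ j, P j ∧ Realized Φ (4 * q) (2 ^ (4 * q) + J v - 1) j A) :
    (B.card : ℝ) ≤ 2 ^ (A + 3) * β := by
  have hex : ∀ v, ∃ t, v ∈ B → ∃ m ∈ models Φ (4 * q) t, P m.2.length ∧ m.2.length ≤ A ∧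
      Covers Φ (4 * q) t m (A - m.2.length) (2 ^ (4 * q) + J v - 1) := by
    intro v
    by_cases hv : v ∈ B
    · obtain ⟨j, hP, hjA, t, m, hm, rfl, hc⟩ := hB v hv
      exact ⟨t, fun _ => ⟨m, hm, hP, hjA, hc⟩⟩
    · exact ⟨0, fun h => absurd h hv⟩
  choose T hT using hex
  set t := B.sup T
  set S := (newModels Φ (4 * q) s t).filter fun m => P m.2.length ∧ m.2.length ≤ A with hS
  have hSm : S ⊆ models Φ (4 * q) t := (filter_subset _ _).trans sdiff_subset
  have h1 := card_covered_le S hSm A fun m hm => (mem_filter.1 hm).2.2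
  have h2 : mass S ≤ β := by
    refine (mass_mono fun m hm => ?_).trans (hβ t)
    obtain ⟨hm1, hm2, -⟩ := mem_filter.1 hm
    exact mem_filter.2 ⟨hm1, hm2⟩
  have h3 : B.card ≤ ((range (2 ^ (4 * q))).filter fun j => ∃ m ∈ S,
      Covers Φ (4 * q) t m (A - m.2.length) (2 ^ (4 * q) + j - 1)).card := by
    refine card_le_card_of_injOn J (fun v hv => ?_) hJ
    obtain ⟨m, hm, hP, hmA, hc⟩ := hT v hv
    have hTt : T v ≤ t := le_sup (f := T) hv
    have hJv := hlt v hv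
    rw [mem_coe, mem_filter, mem_range]
    refine ⟨hJv, m, ?_, (Covers.of_le hm hJv hTt).2 hc⟩
    -- The model is new: had it been available at stage s, its weights would agree at all stages
    -- from s on, and it would have covered the string at the stage t' ≥ s where the string was
    -- chosen outside all models.
    refine mem_filter.2 ⟨mem_sdiff.2 ⟨models_mono hTt hm, fun hms => ?_⟩, hP, hmA⟩
    obtain ⟨t', ht', hn⟩ := hnc v hv
    have hc' : Covers Φ (4 * q) s m (A - m.2.length) (2 ^ (4 * q) + J v - 1) :=
      (Covers.of_le hms hJv (le_max_right (T v) s)).1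
        ((Covers.of_le hm hJv (le_max_left (T v) s)).2 hc)
    exact hn m (models_mono ht' hms) (hmA.trans hA)
      (((Covers.of_le hms hJv ht').2 hc').mono (Nat.sub_le_sub_right hA _))
  calc (B.card : ℝ) ≤ _ := Nat.cast_le.2 h3
    _ ≤ _ := h1
    _ ≤ _ := by gcongr

theorem partrec_eval (Φ : Interpreter) :
    Partrec fun a : List Bool × List ℕ => Φ.eval a.1 a.2 :=
  Partrec.rfindOpt (f := fun (a : List Bool × List ℕ) t => Φ.run t a.1 a.2)
    (computable_run Φ Computable.snd (Computable.fst.comp Computable.fst)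
      (Computable.snd.comp Computable.fst))

/-- The machine that runs a program of `Φ` on a function of the input, and then changes the
output. -/
def transform (Φ : Interpreter) (f : List ℕ → List ℕ) (g : List ℕ → List ℕ → List ℕ) : Machine :=
  fun p y => (Φ.eval p (f y)).map (g y)

/-- Computable changes of the input and the output do not affect which programs are prefixes of each
other, so universality applies. -/
theorem exists_transform (hΦ : IsUniversal ∅ Φ.eval) {f : List ℕ → List ℕ}
    {g : List ℕ → List ℕ → List ℕ} (hf : Computable f) (hg : Computable₂ g) :
    ∃ c : ℕ, ∀ p : List Bool, ∃ r : List Bool, r.length ≤ p.length + c ∧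
      ∀ y, Φ.eval r y = transform Φ f g p y := by
  refine hΦ.2.2 _ (fun y p r hp hr hpr => hΦ.1 (f y) p r hp hr hpr) (Partrec.recursiveIn ?_)
  exact Partrec.map ((partrec_eval Φ).comp (Computable.pair Computable.fst
    (hf.comp Computable.snd))) (hg.comp (Computable.snd.comp Computable.fst) Computable.snd)

theorem exists_program (hΦ : IsUniversal ∅ Φ.eval) (w : List ℕ) :
    ∃ p, ∀ y, w ∈ Φ.eval p y := by
  obtain ⟨c, hc⟩ := hΦ.2.2 (fun p _ => if p = [] then Part.some w else Part.none)
    (fun y p r hp hr _ => by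
      have key : ∀ u : List Bool, (if u = [] then Part.some w else Part.none).Dom → u = [] := by
        intro u hu
        by_contra h
        simp [h] at hu
      rw [key p hp, key r hr])
    (Partrec.recursiveIn (partrec_ite (computable_decide_eq Computable.fst (Computable.const []))
      (Computable.const w).partrec))
  obtain ⟨r, -, hr⟩ := hc []
  exact ⟨r, fun y => by rw [hr]; simp⟩

/-- A shortest program for `x`. -/
theorem exists_length_eq_K {M : Machine} {x : List Bool} {r : List Bool}
    (hr : [code x] ∈ M r [x.length]) :
    ∃ p : List Bool, p.length = K M x ∧ [code x] ∈ M p [x.length] :=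
  Nat.sInf_mem (s := {l | ∃ p : List Bool, p.length = l ∧ [code x] ∈ M p [x.length]}) ⟨_, r, rfl, hr⟩

theorem K_le {M : Machine} {x r : List Bool} (hr : [code x] ∈ M r [x.length]) :
    K M x ≤ r.length := Nat.sInf_le ⟨r, rfl, hr⟩

theorem exists_length_eq_setK (hΦ : IsUniversal ∅ Φ.eval) (S : Finset (List Bool)) :
    ∃ p : List Bool, p.length = setK Φ n S ∧
      ∃ L : List (List Bool), L.toFinset = S ∧ L.map code ∈ Φ.eval p [n] := by
  obtain ⟨p, hp⟩ := exists_program hΦ (S.toList.map code)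
  exact Nat.sInf_mem (s := {l | ∃ p : List Bool, p.length = l ∧
    ∃ L : List (List Bool), L.toFinset = S ∧ L.map code ∈ Φ.eval p [n]})
    ⟨_, p, rfl, S.toList, by simp, hp _⟩

theorem exists_length_eq_probK {P : List Bool → ℝ} (h : ∃ p, ComputesReal Φ n p P) :
    ∃ p : List Bool, p.length = probK Φ n P ∧ ComputesReal Φ n p P :=
  Nat.sInf_mem (s := {l | ∃ p : List Bool, p.length = l ∧ ComputesReal Φ n p P})
    (h.elim fun p hp => ⟨_, p, rfl, hp⟩)

theorem exists_length_eq_funK {F : List Bool → Option (List Bool)}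
    (h : ∃ p, ComputesFun Φ n p F) :
    ∃ p : List Bool, p.length = funK Φ n F ∧ ComputesFun Φ n p F :=
  Nat.sInf_mem (s := {l | ∃ p : List Bool, p.length = l ∧ ComputesFun Φ n p F})
    (h.elim fun p hp => ⟨_, p, rfl, hp⟩)

theorem probK_le {P : List Bool → ℝ} {p : List Bool} (h : ComputesReal Φ n p P) :
    probK Φ n P ≤ p.length := Nat.sInf_le ⟨p, rfl, h⟩

theorem funK_le {F : List Bool → Option (List Bool)} {p : List Bool} (h : ComputesFun Φ n p F) :
    funK Φ n F ≤ p.length := Nat.sInf_le ⟨p, rfl, h⟩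

theorem realized_of_set (hΦ : IsUniversal ∅ Φ.eval) {x : List Bool} {S : Finset (List Bool)}
    (hx : x ∈ S) {l : ℕ} (hl : S.card ≤ 2 ^ l) :
    Realized Φ x.length (code x) (setK Φ x.length S) (setK Φ x.length S + l) := by
  obtain ⟨p, hp, L, rfl, hL⟩ := exists_length_eq_setK (n := x.length) hΦ S
  obtain ⟨t, ht⟩ := Φ.mem_eval.1 hL
  refine ⟨Nat.le_add_right _ _, t, (0, p), mem_models_of_set ht, hp, ?_⟩
  rw [Nat.add_sub_cancel_left]
  exact covers_of_set ht rfl (List.mem_toFinset.1 hx) hl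

theorem realized_of_prob {x : List Bool} {P : List Bool → ℝ} (hP : IsSemimeasure P)
    (hp : ∃ p, ComputesReal Φ x.length p P) {l : ℕ} (hl : l < x.length)
    (hxl : (1 / 2 : ℝ) ^ l ≤ P x) :
    Realized Φ x.length (code x) (probK Φ x.length P) (probK Φ x.length P + l) := by
  obtain ⟨p, hpl, hp⟩ := exists_length_eq_probK hp
  obtain ⟨t, ht, hc⟩ := exists_covers_of_prob hP hp rfl hl hxl
  refine ⟨Nat.le_add_right _ _, t, (1, p), ht, hpl, ?_⟩
  rwa [Nat.add_sub_cancel_left]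

theorem realized_of_fun {x : List Bool} {F : List Bool → Option (List Bool)}
    (hF : PrefixFreeFun F) (hp : ∃ p, ComputesFun Φ x.length p F) {d : List Bool}
    (hd : F d = some x) {l : ℕ} (hl : l ≤ x.length) (hdl : d.length ≤ l) :
    Realized Φ x.length (code x) (funK Φ x.length F) (funK Φ x.length F + l) := by
  obtain ⟨p, hpl, hp⟩ := exists_length_eq_funK hp
  obtain ⟨t, ht, hc⟩ := exists_covers_of_fun hF hp hd hl hdl
  refine ⟨Nat.le_add_right _ _, t, (2, p), ht, hpl, ?_⟩
  rwa [Nat.add_sub_cancel_left]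

theorem realized_of_program {x r : List Bool} (hr : [code x] ∈ Φ.eval r [x.length]) :
    Realized Φ x.length (code x) r.length r.length := by
  obtain ⟨t, ht⟩ := Φ.mem_eval.1 hr
  refine ⟨le_rfl, t, (0, r), mem_models_of_set ht, rfl, ?_⟩
  rw [Nat.sub_self]
  exact covers_of_run ht rfl

theorem isSemimeasure_dirac (x : List Bool) : IsSemimeasure fun y => if y = x then 1 else 0 := by
  refine ⟨fun y => by simp only; split_ifs <;> simp, fun m => ?_⟩
  rw [sum_boole]
  have : (univ.filter fun v : Fin m → Bool => List.ofFn v = x).card ≤ 1 := card_le_one.2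
    fun v hv w hw => List.ofFn_injective ((mem_filter.1 hv).2.trans (mem_filter.1 hw).2.symm)
  exact_mod_cast this

theorem prefixFreeFun_const (x : List Bool) :
    PrefixFreeFun fun d => if d = [] then some x else none := by
  intro d e hd he _
  have key : ∀ u : List Bool, (if u = [] then some x else none).isSome → u = [] := by
    intro u hu
    by_contra h
    simp [h] at hu
  rw [key d hd, key e he]

/-- Needed so that x has a sufficient probabilistic statistic at all; otherwise the infimum in
`statLen` would default to 0. The point mass at x costs O(1) more than x, by running the program of
x and comparing. -/
theorem exists_dirac (hΦ : IsUniversal ∅ Φ.eval) : ∃ c : ℕ, ∀ x r : List Bool,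
    [code x] ∈ Φ.eval r [x.length] → ∃ p : List Bool, p.length ≤ r.length + c ∧
      ComputesReal Φ x.length p fun y => if y = x then 1 else 0 := by
  have hf : Computable fun y : List ℕ => [y.getI 2] :=
    computable_singleton (Primrec.list_getI.to_comp.comp Computable.id (Computable.const 2))
  have hg : Computable₂ fun y w : List ℕ => if w = [y.getI 0] then [2 ^ y.getI 1] else [0] :=
    computable_ite (computable_decide_eq Computable.snd (computable_singleton
      (Primrec.list_getI.to_comp.comp Computable.fst (Computable.const 0))))
      (computable_singleton (computable_two_pow
        (Primrec.list_getI.to_comp.comp Computable.fst (Computable.const 1)))) (Computable.const _)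
  obtain ⟨c, hc⟩ := exists_transform hΦ hf hg
  refine ⟨c, fun x r hr => ?_⟩
  obtain ⟨p, hpl, hp⟩ := hc r
  refine ⟨p, hpl, fun y k => ⟨if y = x then 2 ^ k else 0, ?_, ?_⟩⟩
  · rw [hp, transform]
    refine (Part.mem_map_iff _).2 ⟨[code x], hr, ?_⟩
    by_cases h : y = x
    · simp [h]
    · have : code x ≠ code y := fun h' => h (code_injective h').symm
      simp [h, this]
  · by_cases h : y = x <;> simp [h]

theorem exists_constFun (hΦ : IsUniversal ∅ Φ.eval) : ∃ c : ℕ, ∀ x r : List Bool,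
    [code x] ∈ Φ.eval r [x.length] → ∃ p : List Bool, p.length ≤ r.length + c ∧
      ComputesFun Φ x.length p fun d => if d = [] then some x else none := by
  have hf : Computable fun y : List ℕ => [y.getI 1] :=
    computable_singleton (Primrec.list_getI.to_comp.comp Computable.id (Computable.const 1))
  have hg : Computable₂ fun y w : List ℕ => if y.getI 0 = 0 then w else [] :=
    computable_ite (computable_decide_eq (Primrec.list_getI.to_comp.comp Computable.fst
      (Computable.const 0)) (Computable.const 0)) Computable.snd (Computable.const _)
  obtain ⟨c, hc⟩ := exists_transform hΦ hf hg
  refine ⟨c, fun x r hr => ?_⟩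
  obtain ⟨p, hpl, hp⟩ := hc r
  refine ⟨p, hpl, fun d => ?_⟩
  rw [hp, transform]
  refine (Part.mem_map_iff _).2 ⟨[code x], hr, ?_⟩
  by_cases h : d = []
  · simp [h, code]
  · have : code d ≠ 0 := fun h' => h (code_injective (h'.trans rfl : code d = code []))
    simp [h, this]

/-- If no model of complexity less than `B` is sufficient for `x`, then minimal sufficient
statistics of `x` have complexity at least `B`. -/
theorem exists_le_statLen (hΦ : IsUniversal ∅ Φ.eval) : ∃ κ : ℕ, ∀ a, κ ≤ a →
    ∀ (x r : List Bool) (B : ℕ), [code x] ∈ Φ.eval r [x.length] → K Φ.eval x + a < x.length →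
    (∀ j < B, ¬ Realized Φ x.length (code x) j (K Φ.eval x + a)) →
    (∀ j, j + a < K Φ.eval x → ¬ Realized Φ x.length (code x) j j) →
    ∀ Z, B ≤ statLen Φ a Z x := by
  obtain ⟨c₁, hc₁⟩ := exists_dirac hΦ
  obtain ⟨c₂, hc₂⟩ := exists_constFun hΦ
  refine ⟨max c₁ c₂, fun a ha x r B hr hlen h1 h2 Z => ?_⟩
  obtain ⟨p, hpK, hp⟩ := exists_length_eq_K hr
  have ha1 : c₁ ≤ a := (le_max_left _ _).trans ha
  have ha2 : c₂ ≤ a := (le_max_right _ _).trans ha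
  -- The trivial statistic concentrated on x must be sufficient in both directions. The upper bound
  -- comes from the program of x, the lower one from the absence of models of complexity below K(x)
  -- - a that give x almost full weight.
  have habs : ∀ j, j ≤ K Φ.eval x + a → Realized Φ x.length (code x) j j →
      |(j : ℝ) - K Φ.eval x| ≤ a := by
    intro j hj hR
    have h3 : K Φ.eval x ≤ j + a := not_lt.1 fun h => h2 j h hR
    have h3' : (K Φ.eval x : ℝ) ≤ j + a := by exact_mod_cast h3
    have hj' : (j : ℝ) ≤ K Φ.eval x + a := by exact_mod_cast hj
    exact abs_le.2 ⟨by linarith, by linarith⟩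
  have hmem : ∀ (s : Set ℕ), s.Nonempty → (∀ j ∈ s, B ≤ j) → B ≤ sInf s :=
    fun s hs h => h _ (Nat.sInf_mem hs)
  have hge : ∀ j l, Realized Φ x.length (code x) j (j + l) → j + l ≤ K Φ.eval x + a → B ≤ j :=
    fun j l hR hjl => not_lt.1 fun h => h1 j h (hR.mono hjl)
  cases Z with
  | set =>
    refine hmem _ ⟨_, {x}, ⟨by simp, ?_⟩, rfl⟩ ?_
    · have hR := realized_of_set hΦ (mem_singleton_self x) (l := 0) (by simp)
      have hle : setK Φ x.length {x} ≤ K Φ.eval x :=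
        Nat.sInf_le ⟨p, hpK, [x], by simp, by simpa using hp⟩
      simpa using habs _ (hle.trans (Nat.le_add_right _ _)) hR
    · rintro j ⟨S, ⟨hxS, hS⟩, rfl⟩
      have hc : (1 : ℝ) ≤ S.card := by
        exact_mod_cast card_pos.2 ⟨x, hxS⟩
      have h3 := (abs_le.1 hS).2
      have h4 : 0 ≤ Real.logb 2 S.card := Real.logb_nonneg one_lt_two hc
      have h5 : setK Φ x.length S ≤ K Φ.eval x + a := by
        have : (setK Φ x.length S : ℝ) ≤ K Φ.eval x + a := by linarith
        exact_mod_cast this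
      refine hge _ (K Φ.eval x + a - setK Φ x.length S) (realized_of_set hΦ hxS ?_) (by omega)
      have h6 : Real.logb 2 S.card ≤ ((K Φ.eval x + a - setK Φ x.length S : ℕ) : ℝ) := by
        rw [Nat.cast_sub h5]; push_cast; linarith
      rw [Real.logb_le_iff_le_rpow one_lt_two (by linarith), Real.rpow_natCast] at h6
      exact_mod_cast h6
  | prob =>
    obtain ⟨p', hp'l, hp'⟩ := hc₁ x p hp
    refine hmem _ ⟨_, _, ⟨isSemimeasure_dirac x, ⟨p', hp'⟩, by simp, ?_⟩, rfl⟩ ?_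
    · have hR := realized_of_prob (isSemimeasure_dirac x) ⟨p', hp'⟩ (l := 0) (by omega) (by simp)
      have hle : probK Φ x.length (fun y => if y = x then 1 else 0) ≤ K Φ.eval x + a :=
        (probK_le hp').trans (by omega)
      simpa using habs _ hle hR
    · rintro j ⟨P, ⟨hP, hPc, hPx, hS⟩, rfl⟩
      have h3 := (abs_le.1 hS).2
      have hP1 : P x ≤ 1 := by
        refine le_trans ?_ (hP.2 x.length)
        refine le_trans (le_of_eq ?_) (single_le_sum
          (f := fun v : Fin x.length → Bool => P (List.ofFn v))
          (fun v _ => hP.1 _) (mem_univ x.get))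
        simp
      have h4 : Real.logb 2 (P x) ≤ 0 := Real.logb_nonpos one_lt_two hPx.le hP1
      have h5 : probK Φ x.length P ≤ K Φ.eval x + a := by
        have : (probK Φ x.length P : ℝ) ≤ K Φ.eval x + a := by linarith
        exact_mod_cast this
      refine hge _ (K Φ.eval x + a - probK Φ x.length P)
        (realized_of_prob hP hPc (by omega) ?_) (by omega)
      have h6 : -((K Φ.eval x + a - probK Φ x.length P : ℕ) : ℝ) ≤ Real.logb 2 (P x) := by
        rw [Nat.cast_sub h5]; push_cast; linarith
      rw [Real.le_logb_iff_rpow_le one_lt_two hPx, Real.rpow_neg zero_le_two,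
        Real.rpow_natCast] at h6
      rwa [one_div, inv_pow]
  | func =>
    obtain ⟨p', hp'l, hp'⟩ := hc₂ x p hp
    refine hmem _ ⟨_, _, ⟨prefixFreeFun_const x, ⟨p', hp'⟩, [], by simp, ?_⟩, rfl⟩ ?_
    · have hR := realized_of_fun (prefixFreeFun_const x) ⟨p', hp'⟩ (d := []) (by simp) (l := 0)
        (by omega) (by simp)
      have hle : funK Φ x.length (fun d => if d = [] then some x else none) ≤ K Φ.eval x + a :=
        (funK_le hp').trans (by omega)
      simpa using habs _ hle hR
    · rintro j ⟨F, ⟨hF, hFc, d, hd, hS⟩, rfl⟩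
      have h3 := (abs_le.1 hS).2
      have h5 : funK Φ x.length F + d.length ≤ K Φ.eval x + a := by
        have : (funK Φ x.length F : ℝ) + d.length ≤ K Φ.eval x + a := by linarith
        exact_mod_cast this
      exact hge _ d.length (realized_of_fun hF hFc hd (by omega) le_rfl) h5

end AlgStat

/-! ### The settling times of Ω. -/

namespace AlgStat

open Finset

variable {Φ : Interpreter} {n t s k : ℕ}

open Classical in
/-- The programs that, given `n`, output a string of length `n` within `t` steps. -/
noncomputable def halting (Φ : Interpreter) (n t : ℕ) : Finset (List Bool) :=
  ((range (2 ^ (t + 1))).image uncode).filter fun p =>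
    ∃ x : List Bool, x.length = n ∧ Φ.run t p [n] = some [code x]

theorem mem_halting {p : List Bool} : p ∈ halting Φ n t ↔
    ∃ x : List Bool, x.length = n ∧ Φ.run t p [n] = some [code x] := by
  classical
  rw [halting, mem_filter, and_iff_right_iff_imp]
  rintro ⟨x, -, hx⟩
  have h1 := code_lt p
  have h2 : 2 ^ (p.length + 1) ≤ 2 ^ (t + 1) :=
    Nat.pow_le_pow_right (by simp) (by have := Φ.length_le hx; omega)
  exact mem_image.2 ⟨code p, mem_range.2 (by omega), uncode_code p⟩

theorem halting_mono (h : s ≤ t) : halting Φ n s ⊆ halting Φ n t := fun p hp => by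
  rw [mem_halting] at *
  exact hp.imp fun x hx => ⟨hx.1, Φ.mono h hx.2⟩

/-- The total weight of a set of programs. -/
noncomputable def programMass (S : Finset (List Bool)) : ℝ := ∑ p ∈ S, (1 / 2 : ℝ) ^ p.length

theorem programMass_mono {S T : Finset (List Bool)} (h : S ⊆ T) :
    programMass S ≤ programMass T :=
  sum_le_sum_of_subset_of_nonneg h fun _ _ _ => by positivity

theorem programMass_nonneg (S : Finset (List Bool)) : 0 ≤ programMass S :=
  sum_nonneg fun _ _ => by positivity

theorem programMass_halting_le (hΦ : PrefixFree Φ.eval) : programMass (halting Φ n t) ≤ 1 := by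
  refine kraft_inequality fun p hp r hr h => ?_
  have key : ∀ u ∈ halting Φ n t, (Φ.eval u [n]).Dom := by
    intro u hu
    obtain ⟨x, -, hx⟩ := mem_halting.1 hu
    exact Part.dom_iff_mem.2 ⟨_, Φ.mem_eval.2 ⟨t, hx⟩⟩
  exact hΦ [n] p r (key p hp) (key r hr) h

theorem inv_two_pow_eq (k : ℕ) : (2⁻¹ : ℝ≥0∞) ^ k = ENNReal.ofReal ((1 / 2) ^ k) := by
  rw [ENNReal.ofReal_pow (by norm_num), one_div, ENNReal.ofReal_inv_of_pos (by norm_num)]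
  simp

theorem omegaAt_eq : omegaAt Φ n t = ENNReal.ofReal (programMass (halting Φ n t)) := by
  rw [programMass, ENNReal.ofReal_sum_of_nonneg fun _ _ => by positivity]
  have h : {p : List Bool | ∃ x : List Bool, x.length = n ∧ Φ.run t p [n] = some [code x]} =
      (halting Φ n t : Set (List Bool)) := by
    ext p
    exact mem_halting.symm
  unfold omegaAt
  refine (tsum_congr_set_coe (fun p : List Bool => (2⁻¹ : ℝ≥0∞) ^ p.length) h).trans ?_
  rw [Finset.tsum_subtype' (halting Φ n t) fun p : List Bool => (2⁻¹ : ℝ≥0∞) ^ p.length]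
  exact sum_congr rfl fun p _ => inv_two_pow_eq _

theorem omega_ne_top (hΦ : PrefixFree Φ.eval) : omega Φ n ≠ ⊤ := by
  refine ne_top_of_le_ne_top ENNReal.one_ne_top (iSup_le fun t => ?_)
  rw [omegaAt_eq]
  exact ENNReal.ofReal_le_one.2 (programMass_halting_le hΦ)

theorem programMass_le_settleTime (hΦ : PrefixFree Φ.eval) (t : ℕ) :
    programMass (halting Φ n t) ≤
      programMass (halting Φ n (settleTime Φ n k)) + (1 / 2) ^ k := by
  -- Rules out the default value of the infimum: if the set were empty, the finite supremum Ω would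
  -- be at least Ω + 2^{-k}.
  have hne : {t | omega Φ n - omegaAt Φ n t ≤ 2⁻¹ ^ k}.Nonempty := by
    by_contra hemp
    rw [Set.not_nonempty_iff_eq_empty, Set.eq_empty_iff_forall_notMem] at hemp
    have h1 : omega Φ n + 2⁻¹ ^ k ≤ omega Φ n := by
      conv_lhs => rw [omega, ENNReal.iSup_add]
      refine iSup_le fun t => ?_
      have h2 : ¬ omega Φ n - omegaAt Φ n t ≤ 2⁻¹ ^ k := hemp t
      rw [tsub_le_iff_left, not_le] at h2
      exact h2.le
    refine absurd h1 (not_le.2 (ENNReal.lt_add_right (omega_ne_top hΦ) ?_))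
    exact pow_ne_zero _ (by simp)
  have h1 : omega Φ n - omegaAt Φ n (settleTime Φ n k) ≤ 2⁻¹ ^ k := Nat.sInf_mem hne
  rw [tsub_le_iff_left] at h1
  have h2 := (le_iSup (omegaAt Φ n) t).trans h1
  rw [omegaAt_eq, omegaAt_eq, inv_two_pow_eq, ← ENNReal.ofReal_add (programMass_nonneg _)
    (by positivity), ENNReal.ofReal_le_ofReal_iff
    (add_nonneg (programMass_nonneg _) (by positivity))] at h2
  exact h2

theorem exists_of_lt_settleTime (h : s < settleTime Φ n k) :
    ∃ t, s ≤ t ∧ programMass (halting Φ n s) + (1 / 2) ^ k < programMass (halting Φ n t) := by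
  have h1 : ¬ omega Φ n - omegaAt Φ n s ≤ 2⁻¹ ^ k := Nat.notMem_of_lt_sInf h
  rw [tsub_le_iff_left, not_le] at h1
  obtain ⟨t, ht⟩ := lt_iSup_iff.1 h1
  have hp := programMass_nonneg (halting Φ n s)
  have h2 : programMass (halting Φ n s) + (1 / 2) ^ k < programMass (halting Φ n t) := by
    rw [omegaAt_eq, omegaAt_eq, inv_two_pow_eq, ← ENNReal.ofReal_add hp (by positivity)] at ht
    exact (ENNReal.ofReal_lt_ofReal_iff_of_nonneg (by positivity)).1 ht
  refine ⟨t, ?_, h2⟩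
  by_contra hlt
  have h3 := programMass_mono (halting_mono (Φ := Φ) (n := n) (not_le.1 hlt).le)
  have : (0 : ℝ) < (1 / 2) ^ k := by positivity
  linarith

/-- Each program that contributes newly to Ω is a new set model, so a bound on the mass of new
models also bounds the growth of Ω. -/
theorem programMass_halting_sub_le (h : s ≤ t) :
    programMass (halting Φ n t) ≤ programMass (halting Φ n s) + mass (newModels Φ n s t) := by
  have h1 : programMass (halting Φ n t \ halting Φ n s) + programMass (halting Φ n s) =
      programMass (halting Φ n t) := sum_sdiff (halting_mono h)
  have h2 : programMass (halting Φ n t \ halting Φ n s) ≤ mass (newModels Φ n s t) := by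
    have hinj : Set.InjOn (fun p : List Bool => ((0 : ℕ), p))
        (halting Φ n t \ halting Φ n s : Finset (List Bool)) :=
      fun a _ b _ hab => (Prod.mk.inj hab).2
    have h3 : programMass (halting Φ n t \ halting Φ n s) =
        mass ((halting Φ n t \ halting Φ n s).image fun p => (0, p)) := by
      rw [mass, sum_image hinj, programMass]
    rw [h3]
    refine mass_mono fun m hm => ?_
    obtain ⟨p, hp, rfl⟩ := mem_image.1 hm
    obtain ⟨hp1, hp2⟩ := mem_sdiff.1 hp
    obtain ⟨x, hx, hrun⟩ := mem_halting.1 hp1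
    refine mem_sdiff.2 ⟨mem_models_of_set hrun, fun hps => hp2 ?_⟩
    have h4 := probe_halted (mem_models.1 hps).2
    simp only [probe, if_true] at h4
    exact mem_halting.2 ⟨x, hx, by rw [← run_eq_of_le h4 h, hrun]⟩
  linarith

theorem exists_run_of_Kt_le {x : List Bool} {B : ℕ} (h : Kt Φ t x ≤ B) :
    ∃ p : List Bool, p.length ≤ B ∧ Φ.run t p [x.length] = some [code x] := by
  have hne : {l : ℕ∞ | ∃ p : List Bool, (p.length : ℕ∞) = l ∧
      Φ.run t p [x.length] = some [code x]}.Nonempty := by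
    by_contra hemp
    rw [Set.not_nonempty_iff_eq_empty] at hemp
    rw [Kt, hemp, sInf_empty] at h
    exact absurd h (by simp)
  obtain ⟨p, hp, hr⟩ := csInf_mem hne
  refine ⟨p, ?_, hr⟩
  have : (p.length : ℕ∞) ≤ B := hp.le.trans h
  exact_mod_cast this

theorem Kt_settleTime_le {x p : List Bool} {b : ℕ}
    (hr : Φ.run (settleTime Φ x.length k) p [x.length] = some [code x])
    (hp : p.length ≤ K Φ.eval x + b) :
    Kt Φ (settleTime Φ x.length k) x ≤ (K Φ.eval x : ℕ∞) + b := by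
  refine (sInf_le ⟨p, rfl, hr⟩ : Kt Φ (settleTime Φ x.length k) x ≤ (p.length : ℕ∞)).trans ?_
  exact_mod_cast hp

end AlgStat

/-! ### Counting in the last window. -/

namespace AlgStat

open Finset

variable {Φ : Interpreter} {Ψ : Machine} {lo : ℕ → ℕ → ℕ} {e : ℕ → ℕ} {q n : ℕ}

theorem exists_program_oracle (hΦ : IsUniversal ∅ Φ.eval) {O : Set (ℕ →. ℕ)}
    (hΨ : IsUniversal O Ψ) (p : List Bool) : ∃ r, ∀ y, Ψ r y = Φ.eval p y := by
  obtain ⟨c, hc⟩ := hΨ.2.2 Φ.eval hΦ.1 (Partrec.recursiveIn (partrec_eval Φ))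
  obtain ⟨r, -, hr⟩ := hc p
  exact ⟨r, hr⟩

/-- There are fewer than `2 ^ m` strings of complexity less than `m`. -/
theorem card_K_lt_le {M : Machine} (x : ℕ → List Bool) (B : Finset ℕ) (hx : Set.InjOn x B)
    (hxn : ∀ v ∈ B, (x v).length = n) (m : ℕ)
    (hp : ∀ v ∈ B, ∃ r, [code (x v)] ∈ M r [(x v).length]) (hB : ∀ v ∈ B, K M (x v) < m) :
    B.card ≤ 2 ^ m := by
  have hex : ∀ v, ∃ p : List Bool, v ∈ B → p.length < m ∧ [code (x v)] ∈ M p [n] := by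
    intro v
    by_cases hv : v ∈ B
    · obtain ⟨r, hr⟩ := hp v hv
      obtain ⟨p, hp, hpx⟩ := exists_length_eq_K hr
      exact ⟨p, fun _ => ⟨hp ▸ hB v hv, hxn v hv ▸ hpx⟩⟩
    · exact ⟨[], fun h => absurd h hv⟩
  choose P hP using hex
  rw [← card_range (2 ^ m)]
  refine card_le_card_of_injOn (fun v => code (P v)) (fun v hv => ?_) fun v hv w hw h => ?_
  · have h1 := code_lt (P v)
    have h2 : 2 ^ ((P v).length + 1) ≤ 2 ^ m := Nat.pow_le_pow_right (by simp) (hP v hv).1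
    rw [mem_coe, mem_range]
    simp only
    omega
  · have h3 : P v = P w := code_injective h
    have h4 := (hP w hw).2
    rw [← h3] at h4
    have h5 := Part.mem_unique (hP v hv).2 h4
    exact hx hv hw (code_injective (List.singleton_injective h5))

/-- After the settling time, programs of length at most `l` output few new strings. -/
theorem card_not_halted_le (hΦ : PrefixFree Φ.eval) (x : ℕ → List Bool) (p : ℕ → List Bool)
    (B : Finset ℕ) (hx : Set.InjOn x B) (hxn : ∀ v ∈ B, (x v).length = n)
    (hp : ∀ v ∈ B, [code (x v)] ∈ Φ.eval (p v) [n]) {l k : ℕ} (hl : ∀ v ∈ B, (p v).length ≤ l)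
    (hB : ∀ v ∈ B, Φ.run (settleTime Φ n k) (p v) [n] ≠ some [code (x v)]) :
    (B.card : ℝ) * (1 / 2) ^ l ≤ (1 / 2) ^ k := by
  have hex : ∀ v, ∃ t, v ∈ B → Φ.run t (p v) [n] = some [code (x v)] := by
    intro v
    by_cases hv : v ∈ B
    · exact (Φ.mem_eval.1 (hp v hv)).imp fun _ h _ => h
    · exact ⟨0, fun h => absurd h hv⟩
  choose T hT using hex
  set s := settleTime Φ n k
  set t := max s (B.sup T)
  have hrun : ∀ v ∈ B, Φ.run t (p v) [n] = some [code (x v)] := fun v hv =>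
    Φ.mono ((le_sup (f := T) hv).trans (le_max_right _ _)) (hT v hv)
  have hinj : Set.InjOn p B := fun v hv w hw h => by
    have h1 := hrun v hv
    rw [h, hrun w hw] at h1
    exact hx hv hw (code_injective (List.singleton_injective (Option.some.inj h1)).symm)
  have hsub : B.image p ⊆ halting Φ n t \ halting Φ n s := by
    intro r hr
    obtain ⟨v, hv, rfl⟩ := mem_image.1 hr
    refine mem_sdiff.2 ⟨mem_halting.2 ⟨x v, hxn v hv, hrun v hv⟩, fun h => hB v hv ?_⟩
    obtain ⟨y, -, hy⟩ := mem_halting.1 h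
    have h2 := Φ.mono (le_max_left s (B.sup T)) hy
    rw [hy, ← h2]
    exact hrun v hv
  have h1 : programMass (halting Φ n t \ halting Φ n s) + programMass (halting Φ n s) =
      programMass (halting Φ n t) := sum_sdiff (halting_mono (le_max_left _ _))
  have h2 := programMass_le_settleTime (n := n) (k := k) hΦ t
  have h3 := programMass_mono hsub
  -- Different strings have different programs, each contributing at least 2^{-l} to the part of Ω
  -- that is still missing at the settling time.
  have h4 : (B.card : ℝ) * (1 / 2) ^ l ≤ programMass (B.image p) := by
    rw [programMass, sum_image hinj, ← nsmul_eq_mul]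
    exact card_nsmul_le_sum _ _ _ fun v hv =>
      pow_le_pow_of_le_one (by norm_num) (by norm_num) (hl v hv)
  linarith

theorem exists_notMem_of_card_lt {w : ℕ} (W B₁ B₂ B₃ B₄ B₅ : Finset ℕ) (hw : 0 < w)
    (hW : W.card = w) (h₁ : (B₁.card : ℝ) ≤ w / 8) (h₂ : (B₂.card : ℝ) ≤ w / 8)
    (h₃ : (B₃.card : ℝ) ≤ w / 8) (h₄ : (B₄.card : ℝ) ≤ w / 8) (h₅ : (B₅.card : ℝ) ≤ w / 8) :
    ∃ v ∈ W, v ∉ B₁ ∧ v ∉ B₂ ∧ v ∉ B₃ ∧ v ∉ B₄ ∧ v ∉ B₅ := by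
  by_contra! hcon
  have hsub : W ⊆ B₁ ∪ (B₂ ∪ (B₃ ∪ (B₄ ∪ B₅))) := by
    intro v hv
    have := hcon v hv
    simp only [mem_union]
    tauto
  have h := (card_le_card hsub).trans ((card_union_le _ _).trans (Nat.add_le_add_left
    ((card_union_le _ _).trans (Nat.add_le_add_left ((card_union_le _ _).trans
    (Nat.add_le_add_left (card_union_le _ _) _)) _)) _))
  rw [hW] at h
  have h' : (w : ℝ) ≤ B₁.card + (B₂.card + (B₃.card + (B₄.card + B₅.card))) := by exact_mod_cast h
  have : (0 : ℝ) < w := by exact_mod_cast hw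
  linarith

/-- The strings of the last window. -/
theorem exists_window (hΦ : IsUniversal ∅ Φ.eval) (hlo : Computable₂ lo) (he : Computable e)
    (hmono : ∀ q, Monotone (lo q)) : ∃ c : ℕ, ∀ q, 5 ≤ q →
    (∀ i < 2 ^ (e q + 4), lo q i + 3 ≤ q) →
    ∃ i < 2 ^ (e q + 4), ∃ (s : ℕ) (W : Finset ℕ) (J : ℕ → ℕ) (p : ℕ → List Bool),
      W.card = window lo q i ∧ (∀ t, Quiet Φ lo e q i s t) ∧ Set.InjOn J W ∧
      ∀ v ∈ W, J v < 2 ^ (4 * q) ∧ (p v).length ≤ q + c ∧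
        [2 ^ (4 * q) + J v - 1] ∈ Φ.eval (p v) [4 * q] ∧
        ∃ t, s ≤ t ∧ ∀ m ∈ models Φ (4 * q) t, m.2.length ≤ 2 * q →
          ¬ Covers Φ (4 * q) t m (2 * q - m.2.length) (2 ^ (4 * q) + J v - 1) := by
  obtain ⟨c, hc⟩ := hΦ.2.2 (producer Φ lo e) (prefixFree_producer Φ lo e)
    (Partrec.recursiveIn (partrec_producer Φ hlo he))
  refine ⟨c, fun q hq hloq => ?_⟩
  obtain ⟨i, hi, v₀, s, hv₀, ⟨t₀, ht₀⟩, hs, hQ⟩ := exists_quiet_window hΦ.1 (hmono q) hloq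
  have hex : ∀ v, ∃ (j : ℕ) (p : List Bool), v ∈ Ico v₀ (v₀ + window lo q i) →
      j < 2 ^ (4 * q) ∧ j / 2 ^ (3 * q) = v ∧ p.length ≤ q + c ∧
      [2 ^ (4 * q) + j - 1] ∈ Φ.eval p [4 * q] ∧
      ∃ t, s ≤ t ∧ ∀ m ∈ models Φ (4 * q) t, m.2.length ≤ 2 * q →
        ¬ Covers Φ (4 * q) t m (2 * q - m.2.length) (2 ^ (4 * q) + j - 1) := by
    intro v
    by_cases hv : v ∈ Ico v₀ (v₀ + window lo q i)
    · obtain ⟨hv1, hv2⟩ := mem_Ico.1 hv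
      obtain ⟨t, j, ht, hj, hjv, hM, hcov⟩ := exists_mem_producer (lo := lo) (e := e) hΦ.1 hq
        (hv2.trans hv₀) (hv2.trans_le ht₀)
      obtain ⟨p, hpl, hp⟩ := hc (uncode (2 ^ q + v - 1))
      rw [length_uncode_index (hv2.trans hv₀)] at hpl
      exact ⟨j, p, fun _ => ⟨hj, hjv, hpl, by rw [hp]; exact hM, t, hs t (by omega), hcov⟩⟩
    · exact ⟨0, [], fun h => absurd h hv⟩
  choose J p hJp using hex
  refine ⟨i, hi, s, Ico v₀ (v₀ + window lo q i), J, p, by simp, hQ, ?_, fun v hv => ?_⟩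
  · intro v hv w hw h
    rw [← (hJp v hv).2.1, ← (hJp w hw).2.1, h]
  · obtain ⟨h1, -, h3⟩ := hJp v hv
    exact ⟨h1, h3⟩

theorem two_pow_mul_half_pow {A B C : ℕ} (h : A = B + C) :
    (2 : ℝ) ^ A * (1 / 2) ^ C = 2 ^ B := by
  rw [h, pow_add, mul_assoc, ← mul_pow]
  simp

/-- For all sufficiently large constants `a` and `b` and all lengths whose parameter is large enough,
there is a string of depth about `lo q i` without sufficient statistics of complexity less than
`lo q (i + 1)`, for some `i`. -/
theorem exists_gap (hΦ : IsUniversal ∅ Φ.eval) {O : Set (ℕ →. ℕ)} (hΨ : IsUniversal O Ψ)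
    (hlo : Computable₂ lo) (he : Computable e) (hmono : ∀ q, Monotone (lo q)) :
    ∃ κ : ℕ, ∀ a b q, κ ≤ a → κ ≤ b → a + κ ≤ e q → a + b + κ ≤ q →
      (∀ i < 2 ^ (e q + 4), lo q i + 7 ≤ q) →
      ∀ Z, ∃ x : List Bool, x.length = 4 * q ∧ ∃ i < 2 ^ (e q + 4),
        lo q i < depth Φ b x ∧ depth Φ b x ≤ lo q i + κ ∧ lo q (i + 1) ≤ statLen Φ a Z x ∧
        haltingInfo Φ Ψ x ≤ depth Φ b x + κ := by
  classical
  obtain ⟨c, hc⟩ := exists_window hΦ hlo he hmono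
  obtain ⟨κ, hκ⟩ := exists_le_statLen hΦ
  refine ⟨κ + c + 10, fun a b q ha hb haq hq hloq Z => ?_⟩
  obtain ⟨i, hi, s, W, J, p, hWc, hQ, hJ, hW⟩ := hc q (by omega)
    fun i hi => (Nat.add_le_add_left (by norm_num) _).trans (hloq i hi)
  have hik := hloq i hi
  set n := 4 * q with hn
  set k := lo q i + 3 with hk
  set w := window lo q i with hw
  have hwpos : 0 < w := by rw [hw, window]; positivity
  have hwr : (w : ℝ) = 2 ^ (q - k) := by rw [hw, window]; push_cast; rfl
  set x : ℕ → List Bool := fun v => uncode (2 ^ n + J v - 1) with hx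
  have hcx : ∀ v, code (x v) = 2 ^ n + J v - 1 := fun v => code_uncode _
  have hxn : ∀ v ∈ W, (x v).length = n := fun v hv => length_uncode_index (hW v hv).1
  have hxinj : Set.InjOn x W := by
    intro v hv u hu h
    have h1 := congrArg code h
    rw [hcx, hcx] at h1
    have : 0 < 2 ^ n := by positivity
    exact hJ hv hu (by omega)
  have hprog : ∀ v ∈ W, [code (x v)] ∈ Φ.eval (p v) [(x v).length] := fun v hv => by
    rw [hcx, hxn v hv]; exact (hW v hv).2.2.1
  have hKle : ∀ v ∈ W, K Φ.eval (x v) ≤ q + c := fun v hv =>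
    (K_le (hprog v hv)).trans (hW v hv).2.1
  have hsubJ : ∀ B ⊆ W, Set.InjOn J B := fun B hB => hJ.mono (coe_subset.2 hB)
  have hhalf : (0 : ℝ) < (1 / 2) ^ k := by positivity
  have hkk : (1 / 2 : ℝ) ^ k * 2 ^ k = 1 := by rw [← mul_pow]; simp
  have hmass : ∀ t, mass (newModels Φ n s t) ≤ 6 * (1 / 2) ^ k := by
    intro t
    have h1 := mul_le_mul_of_nonneg_left (hQ t).2.le hhalf.le
    rw [mul_comm, mul_assoc, mul_comm _ ((1 / 2 : ℝ) ^ k), hkk, mul_one] at h1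
    linarith
  -- a family of strings that are covered by later models is small
  have hsmall : ∀ (B : Finset ℕ) (A : ℕ), B ⊆ W → A ≤ 2 * q → A + 9 ≤ q →
      (∀ v ∈ B, ∃ j, Realized Φ n (code (x v)) j A) → (B.card : ℝ) ≤ w / 8 := by
    intro B A hB hA hA' hR
    have h1 := card_realized_le (s := s) (β := 6 * (1 / 2) ^ k) (fun _ => True) B J hA (hsubJ B hB)
      (fun v hv => (hW v (hB hv)).1) (fun v hv => (hW v (hB hv)).2.2.2)
      (fun t => (mass_mono (filter_subset _ _)).trans (hmass t))
      (fun v hv => (hR v hv).imp fun j hj => ⟨trivial, by rw [← hcx]; exact hj⟩)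
    have h2 : (2 : ℝ) ^ (A + 9) ≤ 2 ^ q := pow_le_pow_right₀ (by norm_num) hA'
    have h3 : (2 : ℝ) ^ (A + 3) * (6 * (1 / 2) ^ k) = 2 ^ (A + 9) * (1 / 2) ^ k * (6 / 64) := by
      rw [pow_add, pow_add]; ring
    have h4 := mul_le_mul_of_nonneg_right h2 hhalf.le
    rw [two_pow_mul_half_pow (show q = q - k + k by omega), ← hwr] at h4
    have h5 : (0 : ℝ) ≤ w := Nat.cast_nonneg _
    rw [h3] at h1
    linarith
  -- The five ways in which a string of the window can fail: it is compressible, has a simple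
  -- sufficient model, has a model too cheap for the trivial statistics to be sufficient, is
  -- compressible on Ψ, or its program halts late. Each takes at most an eighth of the window.
  set B₁ := W.filter fun v => K Φ.eval (x v) + 9 < q
  set B₂ := W.filter fun v => ∃ j < lo q (i + 1),
    Realized Φ n (code (x v)) j (K Φ.eval (x v) + a)
  set B₃ := W.filter fun v => ∃ j, j + a < K Φ.eval (x v) ∧ Realized Φ n (code (x v)) j j
  set B₄ := W.filter fun v => K Ψ (x v) < q - k - 4
  set B₅ := W.filter fun v => Φ.run (settleTime Φ n (k + c + 5)) (p v) [n] ≠ some [code (x v)]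
  have hB₁ : (B₁.card : ℝ) ≤ w / 8 := by
    refine hsmall B₁ (q - 9) (filter_subset _ _) (by omega) (by omega) fun v hv => ?_
    obtain ⟨hvW, hv⟩ := mem_filter.1 hv
    obtain ⟨r, hrl, hr⟩ := exists_length_eq_K (hprog v hvW)
    have h1 := realized_of_program hr
    rw [hxn v hvW] at h1
    exact ⟨_, h1.mono (by omega)⟩
  have hB₃ : (B₃.card : ℝ) ≤ w / 8 := by
    refine hsmall B₃ (q + c - a) (filter_subset _ _) (by omega) (by omega) fun v hv => ?_
    obtain ⟨hvW, j, hj, hR⟩ := mem_filter.1 hv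
    have := hKle v hvW
    exact ⟨j, hR.mono (by omega)⟩
  have hB₂ : (B₂.card : ℝ) ≤ w / 8 := by
    have hB : B₂ ⊆ W := filter_subset _ _
    -- The count is at most 2^{q+c+a+3-k-e}, which is below w/8 because e exceeds a + c by a margin;
    -- here the size of e is used.
    have h1 := card_realized_le (s := s) (A := q + c + a) (β := (1 / 2) ^ (k + e q))
      (fun j => j < lo q (i + 1)) B₂ J (by omega) (hsubJ B₂ hB)
      (fun v hv => (hW v (hB hv)).1) (fun v hv => (hW v (hB hv)).2.2.2) (fun t => ?_)
      (fun v hv => ?_)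
    · have h2 : (2 : ℝ) ^ (q + c + a + 3) * (1 / 2) ^ (k + e q) ≤
          2 ^ (q - 3 + e q) * (1 / 2) ^ (k + e q) :=
        mul_le_mul_of_nonneg_right (pow_le_pow_right₀ (by norm_num) (by omega)) (by positivity)
      rw [two_pow_mul_half_pow (show q - 3 + e q = q - k - 3 + (k + e q) by omega)] at h2
      have h3 : (2 : ℝ) ^ (q - k - 3) = w / 8 := by
        rw [hwr, pow_sub₀ _ two_ne_zero (by omega)]; norm_num; ring
      linarith
    · have h2 := (hQ t).1
      have h3 : (newModels Φ n s t).filter (fun m => m.2.length < lo q (i + 1)) ⊆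
          ofLength (lo q i) (lo q (i + 1)) (newModels Φ n s t) := by
        intro m hm
        obtain ⟨hm1, hm2⟩ := mem_filter.1 hm
        refine mem_filter.2 ⟨hm1, ?_, hm2⟩
        -- A single new model of complexity below lo_i would outweigh the bound 6·2^{-k} =
        -- (3/4)·2^{-lo_i} on all new models. So no simple models appear below the range of level i
        -- either.
        by_contra hlt
        have h4 : (1 / 2 : ℝ) ^ m.2.length ≤ mass (newModels Φ n s t) :=
          single_le_sum (f := fun m : ℕ × List Bool => (1 / 2 : ℝ) ^ m.2.length)
            (fun _ _ => by positivity) hm1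
        have h5 : (1 / 2 : ℝ) ^ lo q i ≤ (1 / 2) ^ m.2.length :=
          pow_le_pow_of_le_one (by norm_num) (by norm_num) (by omega)
        have h6 := hmass t
        rw [hk, pow_add] at h6
        have h7 : (0 : ℝ) < (1 / 2) ^ lo q i := by positivity
        linarith
      have h4 := mass_mono h3
      have h5 : (1 / 2 : ℝ) ^ (k + e q) * 2 ^ (k + e q) = 1 := by rw [← mul_pow]; simp
      have h6 : (0 : ℝ) < 2 ^ (k + e q) := by positivity
      refine h4.trans (le_of_mul_le_mul_right ?_ h6)
      rw [h5]
      exact h2.le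
    · obtain ⟨hvW, j, hj, hR⟩ := mem_filter.1 hv
      have := hKle v hvW
      exact ⟨j, hj, by rw [← hcx]; exact hR.mono (by omega)⟩
  have hB₄ : (B₄.card : ℝ) ≤ w / 8 := by
    have hB : B₄ ⊆ W := filter_subset _ _
    have h1 := card_K_lt_le (M := Ψ) (n := n) x B₄ (hxinj.mono (coe_subset.2 hB))
      (fun v hv => hxn v (hB hv)) (q - k - 4) (fun v hv => ?_) fun v hv => (mem_filter.1 hv).2
    · have h2 : (B₄.card : ℝ) ≤ 2 ^ (q - k - 4) := by exact_mod_cast h1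
      have h3 : (2 : ℝ) ^ (q - k - 4) = w / 16 := by
        rw [hwr, pow_sub₀ _ two_ne_zero (by omega)]; norm_num; ring
      have h5 : (0 : ℝ) ≤ w := Nat.cast_nonneg _
      linarith
    -- The string must have a program on Ψ, since otherwise its complexity there would be 0 by
    -- default and the count would fail.
    · obtain ⟨r, hr⟩ := exists_program_oracle hΦ hΨ (p v)
      exact ⟨r, by rw [hr]; exact hprog v (hB hv)⟩
  have hB₅ : (B₅.card : ℝ) ≤ w / 8 := by
    have hB : B₅ ⊆ W := filter_subset _ _
    have h1 := card_not_halted_le (n := n) (l := q + c) (k := k + c + 5) hΦ.1 x p B₅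
      (hxinj.mono (coe_subset.2 hB)) (fun v hv => hxn v (hB hv))
      (fun v hv => by have := hprog v (hB hv); rwa [hxn v (hB hv)] at this)
      (fun v hv => (hW v (hB hv)).2.1) (fun v hv => (mem_filter.1 hv).2)
    have h2 : (0 : ℝ) < 2 ^ (q + c) := by positivity
    have h3 := mul_le_mul_of_nonneg_right h1 h2.le
    have h4 : (1 / 2 : ℝ) ^ (q + c) * 2 ^ (q + c) = 1 := by rw [← mul_pow]; simp
    rw [mul_assoc, h4, mul_one, mul_comm] at h3
    have h5 : (2 : ℝ) ^ (q + c) * (1 / 2) ^ (k + c + 5) = w / 32 := by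
      rw [hwr, show q + c = (q - k) + (k + c) by omega, pow_add _ (k + c) 5, pow_add _ (q - k),
        mul_assoc, ← mul_assoc ((2 : ℝ) ^ (k + c)), ← mul_pow]
      norm_num
      ring
    have h6 : (0 : ℝ) ≤ w := Nat.cast_nonneg _
    linarith
  obtain ⟨v, hv, hv₁, hv₂, hv₃, hv₄, hv₅⟩ :=
    exists_notMem_of_card_lt W B₁ B₂ B₃ B₄ B₅ hwpos hWc hB₁ hB₂ hB₃ hB₄ hB₅
  have g₁ : q ≤ K Φ.eval (x v) + 9 := not_lt.1 fun h => hv₁ (mem_filter.2 ⟨hv, h⟩)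
  have g₂ : ∀ j < lo q (i + 1), ¬ Realized Φ n (code (x v)) j (K Φ.eval (x v) + a) :=
    fun j hj h => hv₂ (mem_filter.2 ⟨hv, j, hj, h⟩)
  have g₃ : ∀ j, j + a < K Φ.eval (x v) → ¬ Realized Φ n (code (x v)) j j :=
    fun j hj h => hv₃ (mem_filter.2 ⟨hv, j, hj, h⟩)
  have g₄ : q - k - 4 ≤ K Ψ (x v) := not_lt.1 fun h => hv₄ (mem_filter.2 ⟨hv, h⟩)
  have g₅ : Φ.run (settleTime Φ n (k + c + 5)) (p v) [n] = some [code (x v)] :=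
    not_not.1 fun h => hv₅ (mem_filter.2 ⟨hv, h⟩)
  have hKv := hKle v hv
  have hxv := hxn v hv
  obtain ⟨-, hpl, -, t, hst, hcov⟩ := hW v hv
  have hmem : k + c + 5 ∈ {k | Kt Φ (settleTime Φ (x v).length k) (x v) ≤
      (K Φ.eval (x v) : ℕ∞) + b} := by
    refine Kt_settleTime_le (p := p v) ?_ (by omega)
    rw [hxv]
    exact g₅
  have hdle : depth Φ b (x v) ≤ k + c + 5 := Nat.sInf_le hmem
  have hdlt : lo q i < depth Φ b (x v) := by
    have h1 : Kt Φ (settleTime Φ (x v).length (depth Φ b (x v))) (x v) ≤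
        (K Φ.eval (x v) : ℕ∞) + b := Nat.sInf_mem ⟨_, hmem⟩
    rw [← Nat.cast_add] at h1
    obtain ⟨r, hrl, hr⟩ := exists_run_of_Kt_le h1
    rw [hxv] at hr
    -- A program of length at most K(x) + b that halts by stage s would be a set model covering x at
    -- the stage where x was chosen. Its length is at most 2q because q exceeds b + c.
    have h2 : s < settleTime Φ n (depth Φ b (x v)) := by
      by_contra hle
      have hr' := Φ.mono ((not_lt.1 hle).trans hst) hr
      have h3 := covers_of_run hr' hxv
      refine hcov (0, r) (mem_models_of_set hr') (by simp only; omega) ?_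
      rw [← hcx]
      exact h3.mono (Nat.zero_le _)
    obtain ⟨t', ht', hlt⟩ := exists_of_lt_settleTime h2
    have h3 := programMass_halting_sub_le (Φ := Φ) (n := n) ht'
    have h4 := hmass t'
    by_contra hle
    have h5 : (1 / 2 : ℝ) ^ lo q i ≤ (1 / 2) ^ depth Φ b (x v) :=
      pow_le_pow_of_le_one (by norm_num) (by norm_num) (not_lt.1 hle)
    rw [hk, pow_add] at h4
    have h6 : (0 : ℝ) < (1 / 2) ^ lo q i := by positivity
    linarith
  refine ⟨x v, hxv, i, hi, hdlt, by omega, ?_, ?_⟩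
  · refine hκ a (by omega) (x v) (p v) _ (hprog v hv) (by omega) ?_ ?_ Z
    · rw [hxv]; exact g₂
    · rw [hxv]; exact g₃
  · unfold haltingInfo
    omega

end AlgStat

/-! ### The two choices of levels. -/

namespace AlgStat

/-- Exponentially growing levels, starting from the first component of `q`. -/
def towerLevel (q i : ℕ) : ℕ := (fun k => 2 ^ k)^[i] q.unpair.1

/-- Levels that are proportional to `q`, with a factor depending on its first component. -/
def linearLevel (q i : ℕ) : ℕ := 2 ^ (2 * i) * (q / 2 ^ (2 * (2 ^ (q.unpair.1 + 4) + 3)))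

theorem computable_unpair_fst : Computable fun q : ℕ => q.unpair.1 :=
  Computable.fst.comp Computable.unpair

theorem computable_towerLevel : Computable₂ towerLevel :=
  (Primrec.nat_iterate (f := fun x : ℕ × ℕ => x.2) (g := fun x : ℕ × ℕ => x.1.unpair.1)
    (h := fun _ k => 2 ^ k) Primrec.snd (Primrec.fst.comp (Primrec.unpair.comp Primrec.fst))
    (primrec_two_pow.comp Primrec.snd).to₂).to_comp

theorem computable_linearLevel : Computable₂ linearLevel := by
  have h1 : Computable fun x : ℕ × ℕ => x.1.unpair.1 :=
    computable_unpair_fst.comp Computable.fst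
  exact computable_mul (computable_two_pow (computable_mul (Computable.const 2) Computable.snd))
    (computable_div Computable.fst (computable_two_pow (computable_mul (Computable.const 2)
      (computable_add (computable_two_pow (computable_add h1 (Computable.const 4)))
        (Computable.const 3)))))

theorem towerLevel_succ (q i : ℕ) : towerLevel q (i + 1) = 2 ^ towerLevel q i :=
  Function.iterate_succ_apply' _ _ _

theorem towerLevel_mono (q : ℕ) : Monotone (towerLevel q) :=
  monotone_nat_of_le_succ fun i => by
    rw [towerLevel_succ]
    exact Nat.lt_two_pow_self.le

theorem linearLevel_mono (q : ℕ) : Monotone (linearLevel q) := fun _ _ h =>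
  Nat.mul_le_mul_right _ (Nat.pow_le_pow_right (by simp) (by omega))

theorem linearLevel_succ (q i : ℕ) : linearLevel q (i + 1) = 4 * linearLevel q i := by
  unfold linearLevel
  ring

theorem infinite_of_length_unbounded {S : Set (List Bool)}
    (h : ∀ N, ∃ x ∈ S, N < x.length) : S.Infinite :=
  Set.Infinite.of_image List.length (Set.infinite_of_forall_exists_gt fun N => by
    obtain ⟨x, hx, hN⟩ := h N
    exact ⟨_, ⟨x, hx, rfl⟩, hN⟩)

/-- Exponentials outgrow powers; passing to the natural exponent ⌈c⌉₊ also covers negative c, since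
d ≥ 1. -/
theorem exists_forall_rpow_le (c : ℝ) (κ : ℕ) : ∃ l₀ : ℕ, ∀ l d : ℕ, l₀ ≤ l → 0 < d → d ≤ l + κ →
    (d : ℝ) ^ c ≤ (2 ^ l : ℕ) := by
  have h := tendsto_pow_const_div_const_pow_of_one_lt ⌈c⌉₊ (one_lt_two (α := ℝ))
  have h2 : (0 : ℝ) < 1 / 2 ^ κ := by positivity
  obtain ⟨l₀, hl₀⟩ := Filter.eventually_atTop.1 (h.eventually (gt_mem_nhds h2))
  refine ⟨l₀, fun l d hl hd hdl => ?_⟩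
  have hd1 : (1 : ℝ) ≤ d := by exact_mod_cast hd
  have h3 := hl₀ (l + κ) (by omega)
  rw [div_lt_iff₀ (by positivity), pow_add, one_div, mul_comm, mul_assoc,
    mul_inv_cancel₀ (by positivity), mul_one] at h3
  calc (d : ℝ) ^ c ≤ (d : ℝ) ^ ((⌈c⌉₊ : ℕ) : ℝ) :=
        Real.rpow_le_rpow_of_exponent_le hd1 (Nat.le_ceil c)
    _ = (d : ℝ) ^ ⌈c⌉₊ := Real.rpow_natCast _ _
    _ ≤ ((l + κ : ℕ) : ℝ) ^ ⌈c⌉₊ := by gcongr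
    _ ≤ (2 ^ l : ℕ) := by push_cast; push_cast at h3; exact h3.le

end AlgStat

theorem proposition5p1 (Φ : AlgStat.Interpreter) (hΦ : AlgStat.IsUniversal ∅ Φ.eval)
    (Ψ : AlgStat.Machine) (hΨ : AlgStat.IsUniversal {AlgStat.haltingOracle Φ} Ψ) :
    ∃ κ : ℕ, ∀ a b : ℕ, κ ≤ a → κ ≤ b → ∀ Z : AlgStat.StatKind, ∃ D : ℕ,
      (∀ (c : ℝ) (m : ℕ),
        {x : List Bool |
          m ≤ AlgStat.depth Φ b x ∧
          (AlgStat.depth Φ b x : ℝ) ^ c - D ≤ AlgStat.statLen Φ a Z x ∧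
          AlgStat.haltingInfo Φ Ψ x ≤ AlgStat.depth Φ b x + D}.Infinite) ∧
      ∃ ν : ℝ, 0 < ν ∧
        {x : List Bool |
          ν * x.length + AlgStat.depth Φ b x - D ≤ AlgStat.statLen Φ a Z x ∧
          AlgStat.haltingInfo Φ Ψ x ≤ AlgStat.depth Φ b x + D}.Infinite := by
  obtain ⟨κ₁, h₁⟩ := AlgStat.exists_gap hΦ hΨ AlgStat.computable_towerLevel
    AlgStat.computable_unpair_fst AlgStat.towerLevel_mono
  obtain ⟨κ₂, h₂⟩ := AlgStat.exists_gap hΦ hΨ AlgStat.computable_linearLevel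
    AlgStat.computable_unpair_fst AlgStat.linearLevel_mono
  refine ⟨max κ₁ κ₂, fun a b ha hb Z => ⟨κ₁ + κ₂ + 3, fun c m => ?_, ?_⟩⟩
  · obtain ⟨l₀, hl₀⟩ := AlgStat.exists_forall_rpow_le c κ₁
    refine AlgStat.infinite_of_length_unbounded fun N => ?_
    -- As e is also level 0, every level is at least m, which makes the depth large, and at least
    -- l₀, where 2^l dominates (l + κ₁)^c. The second component of q is taken beyond the top level
    -- T, so that all levels fit below q.
    set e := a + κ₁ + m + l₀ with he
    set T := (fun k => 2 ^ k)^[2 ^ (e + 4)] e with hT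
    set q := Nat.pair e (a + b + κ₁ + T + 7 + N) with hq
    have hqe : q.unpair.1 = e := by rw [hq, Nat.unpair_pair]
    have hqle : a + b + κ₁ + T + 7 + N ≤ q := Nat.right_le_pair _ _
    have h0 : AlgStat.towerLevel q 0 = e := hqe
    obtain ⟨x, hx, i, -, hd1, hd2, hs, hI⟩ := h₁ a b q ((le_max_left _ _).trans ha)
      ((le_max_left _ _).trans hb) (by omega) (by omega) (fun i hi => by
        have h3 := AlgStat.towerLevel_mono q hi.le
        have h4 : AlgStat.towerLevel q (2 ^ (q.unpair.1 + 4)) = T := by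
          rw [AlgStat.towerLevel, hqe]
        omega) Z
    have hi0 := AlgStat.towerLevel_mono q (Nat.zero_le i)
    rw [AlgStat.towerLevel_succ] at hs
    have hpow := hl₀ _ _ (by omega) (by omega) hd2
    have hs' : ((2 ^ AlgStat.towerLevel q i : ℕ) : ℝ) ≤ AlgStat.statLen Φ a Z x := by
      exact_mod_cast hs
    refine ⟨x, ⟨by omega, ?_, by push_cast; omega⟩, by omega⟩
    have : (0 : ℝ) ≤ ((κ₁ + κ₂ + 3 : ℕ) : ℝ) := Nat.cast_nonneg _
    linarith
  · set e := a + κ₂ with he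
    set M := 2 ^ (2 * (2 ^ (e + 4) + 3)) with hM
    have hMpos : (0 : ℝ) < M := by rw [hM]; positivity
    -- Each level is at least ⌊q/M⌋, so 4 lo_i leaves 3⌊q/M⌋ beyond the depth, up to a constant.
    -- With l(x) = 4q this is the slope 3/(4M), and the rounding of q/M costs the 3 in D.
    refine ⟨3 / (4 * M), by positivity, AlgStat.infinite_of_length_unbounded fun N => ?_⟩
    set q := Nat.pair e (a + b + κ₂ + 8 + N) with hq
    have hqe : q.unpair.1 = e := by rw [hq, Nat.unpair_pair]
    have hqle : a + b + κ₂ + 8 + N ≤ q := Nat.right_le_pair _ _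
    have hlev : ∀ i, AlgStat.linearLevel q i = 2 ^ (2 * i) * (q / M) := fun i => by
      rw [AlgStat.linearLevel, hqe]
    obtain ⟨x, hx, i, -, hd1, hd2, hs, hI⟩ := h₂ a b q ((le_max_right _ _).trans ha)
      ((le_max_right _ _).trans hb) (by omega) (by omega) (fun i hi => by
        rw [hqe] at hi
        have h3 : 64 * AlgStat.linearLevel q i ≤ q := by
          rw [hlev]
          calc 64 * (2 ^ (2 * i) * (q / M)) = 2 ^ (2 * i + 6) * (q / M) := by ring
            _ ≤ M * (q / M) :=
              Nat.mul_le_mul_right _ (Nat.pow_le_pow_right (by simp) (by omega))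
            _ ≤ q := Nat.mul_div_le _ _
        omega) Z
    rw [AlgStat.linearLevel_succ] at hs
    have hs' : 4 * (AlgStat.linearLevel q i : ℝ) ≤ AlgStat.statLen Φ a Z x := by
      exact_mod_cast hs
    have hd2' : (AlgStat.depth Φ b x : ℝ) ≤ AlgStat.linearLevel q i + κ₂ := by exact_mod_cast hd2
    have h4 : (q / M : ℕ) ≤ AlgStat.linearLevel q i := by
      rw [hlev]
      exact Nat.le_mul_of_pos_left _ (by positivity)
    have h4' : ((q / M : ℕ) : ℝ) ≤ AlgStat.linearLevel q i := by exact_mod_cast h4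
    have h5 : (q : ℝ) / M ≤ (q / M : ℕ) + 1 := by
      rw [div_le_iff₀ hMpos]
      have := (Nat.lt_mul_div_succ q (show 0 < M by exact_mod_cast hMpos)).le
      rw [mul_comm] at this
      exact_mod_cast this
    refine ⟨x, ⟨?_, by push_cast; omega⟩, by omega⟩
    rw [hx]
    have h6 : 3 / (4 * (M : ℝ)) * ((4 * q : ℕ) : ℝ) = 3 * (q / M) := by
      push_cast
      field_simp
    rw [h6]
    push_cast
    have : (0 : ℝ) ≤ κ₁ := Nat.cast_nonneg _
    linarith
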